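/- Let $d\ge 0$ be an integer and let $\mathbb G$ be $\mathbb Z^d$, $\mathbb R^d$, or one of the semigroups $\mathbb Z_+^d$, $\mathbb R_+^d$ of vectors with nonnegative coordinates. Let $\nu$ be counting measure on $\mathbb G$ in the discrete cases and Lebesgue measure in the continuous cases, and put $F_n=[0,n]^d\cap\mathbb G$. Let $(X,\Sigma,\mu)$ be a standard probability space and let $T=\{T^j:j\in\mathbb G\}$ be a measurable measure preserving action of $\mathbb G$ on it which is ergodic: every $A\in\Sigma$ with $(T^j)^{-1}A=A$ for all $j\in\mathbb G$ has $\mu(A)\in\{0,1\}$. Let $U^jf=f\circ T^j$ be the Koopman operators on the complex Hilbert space $L^2(X,\mu)$. A function $f\in L^2(X,\mu)$ is *almost periodic* if the closure of $\{U^jf:j\in\mathbb G\}$ is compact in $L^2(X,\mu)$; $H_{ap}$ denotes the set of almost periodic functions. A point $x\in X$ is *generic for $|f|^2$* if $\lim_{n\to\infty}\frac1{\nu(F_n)}\int_{F_n}|f(T^jx)|^2\,d\nu(j)=\int_X|f|^2\,d\mu$. For $x,y\in X$ put $$d_f(x,y)=\limsup_{n\to\infty}\left(\frac1{\nu(F_n)}\int_{F_n}|f(T^jx)-f(T^jy)|^2\,d\nu(j)\right)^{1/2}.$$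 The function $f\in L^2(X,\mu)$ is *$\mu$-mean sensitive* if there is $\varepsilon>0$ such that every $A\in\Sigma$ with $\mu(A)>0$ contains points $x,y$, both generic for $|f|^2$, with $d_f(x,y)>\varepsilon$ (this does not depend on the choice of the measurable representative of $f$); $H_{ms}$ denotes the set of $\mu$-mean sensitive functions. Then $H_{ap}^c=H_{ms}$, the complement being taken in $L^2(X,\mu)$: a function $f\in L^2(X,\mu)$ is $\mu$-mean sensitive if and only if it is not almost periodic. -/

import Mathlib

open MeasureTheory Filter Topology
open scoped ENNReal NNReal

noncomputable section

namespace MeanSensitivity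

/-- `T` is a measure preserving action of the (semi)group `G` on `(X, μ)`, jointly measurable in
time and space. For countable discrete `G` joint measurability just says that every `T j` is
measurable. -/
structure IsMPS {G X : Type*} [AddCommMonoid G] [MeasurableSpace G] [MeasurableSpace X]
    (μ : Measure X) (T : G → X → X) : Prop where
  measurable_uncurry : Measurable (fun p : G × X => T p.1 p.2)
  map_zero : ∀ x, T 0 x = x
  map_add : ∀ i j x, T (i + j) x = T i (T j x)
  measurePreserving : ∀ j, MeasurePreserving (T j) μ μ

/-- An ergodic system: every measurable set invariant under all `T j` has measure `0` or `1`. -/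
structure IsErgodicMPS {G X : Type*} [AddCommMonoid G] [MeasurableSpace G] [MeasurableSpace X]
    (μ : Measure X) (T : G → X → X) : Prop extends IsMPS μ T where
  ergodic : ∀ A : Set X, MeasurableSet A → (∀ j, T j ⁻¹' A = A) → μ A = 0 ∨ μ A = 1

/-- The Koopman operator `f ↦ f ∘ S` on the complex Hilbert space `L²(X, μ)`. -/
def koopman {X : Type*} [MeasurableSpace X] {μ : Measure X} {S : X → X}
    (hS : MeasurePreserving S μ μ) : Lp ℂ 2 μ →ₗᵢ[ℂ] Lp ℂ 2 μ :=
  Lp.compMeasurePreservingₗᵢ ℂ S hS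

/-- The set `H_ap` of almost periodic functions: the orbit under the Koopman operators has
compact closure in `L²(X, μ)`. -/
def almostPeriodic {G X : Type*} [AddCommMonoid G] [MeasurableSpace G] [MeasurableSpace X]
    {μ : Measure X} {T : G → X → X} (hT : IsMPS μ T) : Set (Lp ℂ 2 μ) :=
  {f | IsCompact (closure (Set.range fun j : G => koopman (hT.measurePreserving j) f))}

/-- The cube `F_n = [0, n]^d` in `R^d`. -/
def cube (R : Type*) [Semiring R] [Preorder R] (d n : ℕ) : Set (Fin d → R) :=
  Set.Icc 0 (fun _ => (n : R))

/-- Lebesgue measure on `ℝ₊^d`, i.e. the measure of a set is that of its image in `ℝ^d`. -/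
def orthantVolume (d : ℕ) : Measure (Fin d → ℝ≥0) :=
  (volume : Measure (Fin d → ℝ)).comap (fun v i => (v i : ℝ))

/-- The average of `φ ≥ 0` over the cube `F_n` with respect to `ν`. -/
def cubeAverage {R : Type*} [Semiring R] [Preorder R] [MeasurableSpace R] {d : ℕ}
    (ν : Measure (Fin d → R)) (n : ℕ) (φ : (Fin d → R) → ℝ≥0∞) : ℝ≥0∞ :=
  (∫⁻ j in cube R d n, φ j ∂ν) / ν (cube R d n)

/-- `x` is a generic point for `|f|²`: the averages of `|f|²` along the orbit of `x` converge to
`∫ |f|² dμ`. -/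
def IsGenericSq {R X : Type*} [Semiring R] [Preorder R] [MeasurableSpace R] [MeasurableSpace X]
    {d : ℕ} (ν : Measure (Fin d → R)) (μ : Measure X) (T : (Fin d → R) → X → X)
    (f : X → ℂ) (x : X) : Prop :=
  Tendsto (fun n => cubeAverage ν n fun j => ‖f (T j x)‖ₑ ^ 2) atTop (𝓝 (∫⁻ z, ‖f z‖ₑ ^ 2 ∂μ))

/-- The pseudometric `d_f(x, y)`, with values in `[0, ∞]`; it is finite at generic points. -/
def meanDist {R X : Type*} [Semiring R] [Preorder R] [MeasurableSpace R]
    {d : ℕ} (ν : Measure (Fin d → R)) (T : (Fin d → R) → X → X) (f : X → ℂ) (x y : X) : ℝ≥0∞ :=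
  limsup (fun n => (cubeAverage ν n fun j => ‖f (T j x) - f (T j y)‖ₑ ^ 2) ^ (1 / 2 : ℝ)) atTop

/-- The set `H_ms` of `μ`-mean sensitive functions in `L²(X, μ)`; as everywhere with `d_f`, only
points that are generic for `|f|²` are considered. -/
def meanSensitive {R X : Type*} [Semiring R] [Preorder R] [MeasurableSpace R] [MeasurableSpace X]
    {d : ℕ} (ν : Measure (Fin d → R)) (μ : Measure X) (T : (Fin d → R) → X → X) :
    Set (Lp ℂ 2 μ) :=
  {f | ∃ ε : ℝ, 0 < ε ∧ ∀ A : Set X, MeasurableSet A → 0 < μ A →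
    ∃ x ∈ A, ∃ y ∈ A, IsGenericSq ν μ T f x ∧ IsGenericSq ν μ T f y ∧
      ENNReal.ofReal ε < meanDist ν T f x y}

end MeanSensitivity

end

/-!
# Mean sensitive functions are the functions that are not almost periodic

Both implications rest on the pointwise ergodic theorem for averages over the cubes `F_n`, applied
to integrable functions of the form `‖f ∘ T s - f ∘ T t‖²` on `X` and `(x, y) ↦ ‖f x - f y‖²` on
`X × X`.

**Not almost periodic implies mean sensitive.** For fixed `s, t` the ergodic theorem says that
`d_f (T s x) (T t x) = ‖U^s f - U^t f‖` for almost every `x`: almost every orbit is an isometric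
copy of the orbit of `f` (`ae_meanDist_orbit`). If the orbit of `f` is not totally bounded, it
contains an infinite `δ`-separated sequence `U^{s n} f`. Given `A` of positive measure, the sets
`T (s n)⁻¹ A` all have measure `μ A`, so two of them meet in a typical point `x`, and then
`T (s i) x` and `T (s j) x` are generic points of `A` at `d_f`-distance at least `δ`.

**Almost periodic implies not mean sensitive.** If the orbit of `f` is totally bounded, all the
`U^j f` are within `r` of finitely many functions, which may be replaced by simple ones. Let `π` be
the finite partition of `X` generated by these and `λ` the self-coupling of `μ` that joins two
`μ`-random points conditioned to lie in the same atom of `π`. Under `λ` the expectation of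
`‖f (T j x) - f (T j y)‖²` is at most a multiple of `r²`, uniformly in `j`
(`exists_selfCoupling_of_almostPeriodic`). By the ergodic theorem on `X × X` the averages of this
quantity over `F_n` converge almost everywhere, also for `λ ≪ μ × μ`, and Fatou's lemma bounds the
`λ`-expectation of the limit `d_f (x, y)²`. Hence `d_f` is small on a set of positive `μ × μ`
measure, so some `d_f`-ball of small radius has positive measure, and by the triangle inequality
this ball witnesses that `f` is not mean sensitive.

**The pointwise ergodic theorem.** A Vitali type covering argument in `ℕ^d`
(`mul_card_le_of_cube_sums`) and transference give a weak type `(1, 1)` maximal inequality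
(`exists_weak_type_maximal`), for real time by first integrating over unit cells. The convergence
then follows by approximation: for bounded `φ` the element `g` of minimal norm in the closed convex
hull of the orbit of `φ` in `L²` is invariant, the averages of convex combinations of the
`φ ∘ T s` are asymptotic to those of `φ`, and the averages of `g` are constant; the passage to
integrable `φ` is by truncation. In an ergodic system the limit is the integral.

The four time (semi)groups are treated together through the predicate `IsCubeMeasure`.
-/

namespace MeanSensitivity

/-! ### Cubes and the four time semigroups -/

/-- The properties of the time semigroup `R^d` and its measure `ν` used below. They hold for the
counting measures on `ℤ^d` and `ℕ^d`, Lebesgue measure on `ℝ^d` and its analogue on `ℝ₊^d`. As all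
averages are over cubes in the positive orthant, translation invariance is only required for
translations of the orthant into itself. In `measure_cube` the number `a` is the number of extra
points in the side of a cube, `1` for discrete and `0` for continuous time. -/
structure IsCubeMeasure {R : Type*} [CommSemiring R] [PartialOrder R] [MeasurableSpace R] {d : ℕ}
    (ν : Measure (Fin d → R)) : Prop where
  sFinite : SFinite ν
  measurableSet_Icc : ∀ s t : Fin d → R, MeasurableSet (Set.Icc s t)
  measure_cube : ∃ a : ℕ, ∀ n : ℕ, ν (cube R d n) = ((n + a : ℕ) : ℝ≥0∞) ^ d
  map_add : ∀ s : Fin d → R, 0 ≤ s →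
    (ν.restrict (Set.Ici 0)).map (· + s) = ν.restrict (Set.Ici s)
  exists_floor : ∀ r : R, 0 ≤ r → ∃ k : ℕ, (k : R) ≤ r ∧ r ≤ k + 1
  exists_compl : ∀ r : R, ∃ m₀ : ℕ, ∀ m : ℕ, m₀ ≤ m → 0 ≤ r + m ∧ ∃ i : R, 0 ≤ i ∧ i + r = m

theorem isCubeMeasure_count_int (d : ℕ) : IsCubeMeasure (Measure.count : Measure (Fin d → ℤ)) where
  sFinite := inferInstance
  measurableSet_Icc _ _ := measurableSet_Icc
  measure_cube := by
    refine ⟨1, fun n => ?_⟩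
    rw [cube, ← Finset.coe_Icc, Measure.count_apply_finset]
    simp [Pi.card_Icc]
  map_add s hs := by
    ext A hA
    rw [Measure.map_apply (measurable_add_const s) hA,
      Measure.restrict_apply ((measurable_add_const s) hA), Measure.restrict_apply hA]
    rw [Measure.count_apply (by measurability), Measure.count_apply (by measurability)]
    have : A ∩ Set.Ici s = (· + s) '' ((· + s) ⁻¹' A ∩ Set.Ici 0) := by
      ext x
      simp only [Set.mem_inter_iff, Set.mem_Ici, Set.mem_image, Set.mem_preimage]
      constructor
      · rintro ⟨h1, h2⟩
        exact ⟨x - s, ⟨by simpa using h1, by simpa using h2⟩, by simp⟩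
      · rintro ⟨y, ⟨h1, h2⟩, rfl⟩
        exact ⟨h1, by simpa using h2⟩
    rw [this, (add_left_injective s).encard_image]
  exists_floor r hr := ⟨r.toNat, by simp [hr], by simp [hr]⟩
  exists_compl r := ⟨r.natAbs, fun m hm => ⟨by grind, m - r, by grind, by ring⟩⟩

theorem isCubeMeasure_count_nat (d : ℕ) : IsCubeMeasure (Measure.count : Measure (Fin d → ℕ)) where
  sFinite := inferInstance
  measurableSet_Icc _ _ := measurableSet_Icc
  measure_cube := by
    refine ⟨1, fun n => ?_⟩
    rw [cube, ← Finset.coe_Icc, Measure.count_apply_finset]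
    simp [Pi.card_Icc]
  map_add s hs := by
    ext A hA
    rw [Measure.map_apply (measurable_add_const s) hA,
      Measure.restrict_apply ((measurable_add_const s) hA), Measure.restrict_apply hA]
    rw [Measure.count_apply (by measurability), Measure.count_apply (by measurability)]
    have : A ∩ Set.Ici s = (· + s) '' ((· + s) ⁻¹' A ∩ Set.Ici 0) := by
      ext x
      simp only [Set.mem_inter_iff, Set.mem_Ici, Set.mem_image, Set.mem_preimage]
      constructor
      · rintro ⟨h1, h2⟩
        have : x - s + s = x := by ext i; simp [h2 i]
        exact ⟨x - s, ⟨by rwa [this], fun i => Nat.zero_le _⟩, this⟩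
      · rintro ⟨y, ⟨h1, h2⟩, rfl⟩
        exact ⟨h1, by simp⟩
    rw [this, (add_left_injective s).encard_image]
  exists_floor r hr := ⟨r, by simp, by simp⟩
  exists_compl r := ⟨r, fun m hm => ⟨by simp, m - r, by simp, by simp; omega⟩⟩

theorem isCubeMeasure_volume (d : ℕ) : IsCubeMeasure (volume : Measure (Fin d → ℝ)) where
  sFinite := inferInstance
  measurableSet_Icc _ _ := measurableSet_Icc
  measure_cube := by
    refine ⟨0, fun n => ?_⟩
    rw [cube, Real.volume_Icc_pi]
    simp
  map_add s hs := by
    have h := (measurePreserving_add_right (volume : Measure (Fin d → ℝ)) s).restrict_preimage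
      (measurableSet_Ici (a := s))
    have h2 : (· + s) ⁻¹' (Set.Ici s) = Set.Ici (0 : Fin d → ℝ) := by
      ext x; simp
    rw [h2] at h
    exact h.map_eq
  exists_floor r hr := ⟨⌊r⌋₊, Nat.floor_le hr, (Nat.lt_floor_add_one r).le⟩
  exists_compl r := ⟨⌈|r|⌉₊, fun m hm => by
    have h : |r| ≤ m := (Nat.le_ceil _).trans (by exact_mod_cast hm)
    exact ⟨by linarith [neg_abs_le r], m - r, by linarith [le_abs_self r], by ring⟩⟩

theorem measurableEmbedding_coe_orthant (d : ℕ) :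
    MeasurableEmbedding (fun (v : Fin d → ℝ≥0) (i : Fin d) => (v i : ℝ)) := by
  refine (Topology.IsClosedEmbedding.measurableEmbedding ?_)
  refine .of_continuous_injective_isClosedMap (by fun_prop) (fun v w h => ?_) ?_
  · ext i; exact congrFun h i
  · exact (Topology.IsClosedEmbedding.piMap fun _ : Fin d =>
      NNReal.isClosedEmbedding_coe).isClosedMap

theorem orthantVolume_apply {d : ℕ} (A : Set (Fin d → ℝ≥0)) :
    orthantVolume d A = volume ((fun v i => (v i : ℝ)) '' A : Set (Fin d → ℝ)) :=
  (measurableEmbedding_coe_orthant d).comap_apply _ _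

theorem isCubeMeasure_orthantVolume (d : ℕ) : IsCubeMeasure (orthantVolume d) where
  sFinite := by
    have : SigmaFinite (orthantVolume d) := by
      refine ⟨⟨⟨fun n => cube ℝ≥0 d n, fun _ => trivial, fun n => ?_, ?_⟩⟩⟩
      · rw [orthantVolume_apply]
        have : (fun v i => (v i : ℝ)) '' cube ℝ≥0 d n ⊆ cube ℝ d n := by
          rintro x ⟨v, ⟨-, h⟩, rfl⟩
          exact ⟨fun i => (v i).2, fun i => by exact_mod_cast h i⟩
        exact (measure_mono this).trans_lt isCompact_Icc.measure_lt_top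
      · refine Set.eq_univ_of_forall fun x => Set.mem_iUnion.2 ?_
        obtain ⟨n, hn⟩ := exists_nat_ge (∑ i, x i)
        exact ⟨n, fun _ => zero_le, fun i =>
          (Finset.single_le_sum (fun _ _ => zero_le) (Finset.mem_univ i)).trans hn⟩
    infer_instance
  measurableSet_Icc _ _ := measurableSet_Icc
  measure_cube := by
    refine ⟨0, fun n => ?_⟩
    rw [orthantVolume_apply]
    have : (fun v i => (v i : ℝ)) '' cube ℝ≥0 d n = cube ℝ d n := by
      ext x
      simp only [cube, Set.mem_image, Set.mem_Icc, Pi.le_def]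
      constructor
      · rintro ⟨v, ⟨-, h⟩, rfl⟩
        exact ⟨fun i => (v i).2, fun i => by exact_mod_cast h i⟩
      · rintro ⟨h0, h1⟩
        exact ⟨fun i => ⟨x i, h0 i⟩, ⟨fun i => h0 i, fun i => by exact_mod_cast h1 i⟩, rfl⟩
    rw [this, cube, Real.volume_Icc_pi]
    simp
  map_add s hs := by
    ext A hA
    rw [Measure.map_apply (measurable_add_const s) hA,
      Measure.restrict_apply ((measurable_add_const s) hA), Measure.restrict_apply hA,
      orthantVolume_apply, orthantVolume_apply,
      ← measure_preimage_add_right volume (fun i => (s i : ℝ)) (_ '' (A ∩ Set.Ici s))]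
    congr 1
    ext x
    simp only [Set.mem_image, Set.mem_preimage, Set.mem_inter_iff, Set.mem_Ici]
    constructor
    · rintro ⟨v, ⟨h1, -⟩, rfl⟩
      exact ⟨v + s, ⟨h1, by simp⟩, by ext i; simp⟩
    · rintro ⟨w, ⟨h1, h2⟩, h3⟩
      have h4 : w - s + s = w := tsub_add_cancel_of_le h2
      refine ⟨w - s, ⟨by rwa [h4], fun _ => zero_le⟩, ?_⟩
      ext i
      have := congrFun h3 i
      simp only [Pi.add_apply, Pi.sub_apply] at this ⊢
      rw [NNReal.coe_sub (h2 i)]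
      linarith
  exists_floor r hr := ⟨⌊r⌋₊, Nat.floor_le hr, (Nat.lt_floor_add_one r).le⟩
  exists_compl r := ⟨⌈r⌉₊, fun m hm => by
    have h : r ≤ m := (Nat.le_ceil _).trans (by exact_mod_cast hm)
    exact ⟨zero_le, m - r, zero_le, tsub_add_cancel_of_le h⟩⟩

/-! ### Cubes in general time and a covering lemma -/

section Cubes

variable {R : Type*} [CommSemiring R] [PartialOrder R] [IsStrictOrderedRing R] [MeasurableSpace R]
  [MeasurableAdd R] {d : ℕ} {ν : Measure (Fin d → R)}

omit [MeasurableSpace R] [MeasurableAdd R] in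
theorem cube_mono {m n : ℕ} (h : m ≤ n) : cube R d m ⊆ cube R d n :=
  Set.Icc_subset_Icc_right fun _ => Nat.mono_cast h

omit [IsStrictOrderedRing R] [MeasurableAdd R] in
theorem IsCubeMeasure.measurableSet_cube (hν : IsCubeMeasure ν) (n : ℕ) :
    MeasurableSet (cube R d n) :=
  hν.measurableSet_Icc _ _

omit [IsStrictOrderedRing R] in
theorem lintegral_Ici_add (hν : IsCubeMeasure ν) {s : Fin d → R} (hs : 0 ≤ s)
    {φ : (Fin d → R) → ℝ≥0∞} (hφ : Measurable φ) :
    ∫⁻ j in Set.Ici 0, φ (j + s) ∂ν = ∫⁻ j in Set.Ici s, φ j ∂ν := by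
  rw [← hν.map_add s hs, lintegral_map hφ (measurable_add_const s)]

omit [MeasurableAdd R] in
theorem exists_natCast_ge (hν : IsCubeMeasure ν) {s : Fin d → R} (hs : 0 ≤ s) :
    ∃ k : ℕ, ∀ i, s i ≤ k := by
  choose k hk using fun i => hν.exists_floor (s i) (hs i)
  refine ⟨∑ i, (k i + 1), fun i => (hk i).2.trans ?_⟩
  have : k i + 1 ≤ ∑ i, (k i + 1) :=
    Finset.single_le_sum (f := fun i => k i + 1) (fun _ _ => Nat.zero_le _) (Finset.mem_univ i)
  exact_mod_cast Nat.mono_cast (α := R) this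

/-- A translate of the cube `F_n` by `s ≥ 0` lies in `F_{n + k}`, where `k` depends on `s` only.
Together with `tendsto_measure_cube_div` this is the only form of the Følner property in use. -/
theorem exists_lintegral_cube_add_le (hν : IsCubeMeasure ν) {s : Fin d → R} (hs : 0 ≤ s) :
    ∃ k : ℕ, ∀ (n : ℕ) (φ : (Fin d → R) → ℝ≥0∞), Measurable φ →
      ∫⁻ j in cube R d n, φ (j + s) ∂ν ≤ ∫⁻ j in cube R d (n + k), φ j ∂ν := by
  obtain ⟨k, hk⟩ := exists_natCast_ge hν hs
  refine ⟨k, fun n φ hφ => ?_⟩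
  have hm := hν.measurableSet_cube
  calc ∫⁻ j in cube R d n, φ (j + s) ∂ν
      ≤ ∫⁻ j in cube R d n, (cube R d (n + k)).indicator φ (j + s) ∂ν := by
        refine setLIntegral_mono' (hm n) fun j hj => ?_
        rw [Set.indicator_of_mem]
        refine ⟨add_nonneg hj.1 hs, fun i => ?_⟩
        simpa using add_le_add (hj.2 i) (hk i)
    _ ≤ ∫⁻ j in Set.Ici 0, (cube R d (n + k)).indicator φ (j + s) ∂ν :=
        lintegral_mono_set fun j hj => hj.1
    _ = ∫⁻ j in Set.Ici s, (cube R d (n + k)).indicator φ j ∂ν :=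
        lintegral_Ici_add hν hs (hφ.indicator (hm _))
    _ ≤ ∫⁻ j, (cube R d (n + k)).indicator φ j ∂ν := setLIntegral_le_lintegral _ _
    _ = ∫⁻ j in cube R d (n + k), φ j ∂ν := lintegral_indicator (hm _) _

/-- The cube `F_n` is covered by `(n + 1)^d` translates of `F_1`, so that integrals over it are
dominated by sums over discrete cubes. -/
theorem lintegral_cube_le_sum (hν : IsCubeMeasure ν) (n : ℕ) {φ : (Fin d → R) → ℝ≥0∞}
    (hφ : Measurable φ) :
    ∫⁻ j in cube R d n, φ j ∂ν ≤
      ∑ k ∈ Finset.Icc (0 : Fin d → ℕ) (fun _ => n),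
        ∫⁻ j in cube R d 1, φ (j + fun i => (k i : R)) ∂ν := by
  have hm := hν.measurableSet_cube
  have hcast : ∀ k : Fin d → ℕ, (0 : Fin d → R) ≤ fun i => (k i : R) := fun k i => Nat.cast_nonneg _
  have hcov : ∀ x ∈ cube R d n, ∃ k ∈ Finset.Icc (0 : Fin d → ℕ) (fun _ => n),
      ∀ i, (k i : R) ≤ x i ∧ x i ≤ k i + 1 := by
    intro x hx
    choose k hk using fun i => hν.exists_floor (x i) (hx.1 i)
    refine ⟨k, Finset.mem_Icc.2 ⟨fun _ => Nat.zero_le _, fun i => ?_⟩, hk⟩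
    exact Nat.cast_le.1 ((hk i).1.trans (hx.2 i))
  calc ∫⁻ j in cube R d n, φ j ∂ν
      ≤ ∫⁻ j in cube R d n, ∑ k ∈ Finset.Icc (0 : Fin d → ℕ) (fun _ => n),
          (Set.Icc (fun i => (k i : R)) (fun i => k i + 1)).indicator φ j ∂ν := by
        refine setLIntegral_mono' (hm n) fun j hj => ?_
        obtain ⟨k, hk, hk'⟩ := hcov j hj
        have h1 : φ j = (Set.Icc (fun i => (k i : R)) (fun i => k i + 1)).indicator φ j := by
          rw [Set.indicator_of_mem]
          exact ⟨fun i => (hk' i).1, fun i => (hk' i).2⟩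
        rw [h1]
        exact Finset.single_le_sum (f := fun k : Fin d → ℕ =>
          (Set.Icc (fun i => (k i : R)) (fun i => k i + 1)).indicator φ j) (fun _ _ => zero_le) hk
    _ ≤ ∫⁻ j, ∑ k ∈ Finset.Icc (0 : Fin d → ℕ) (fun _ => n),
          (Set.Icc (fun i => (k i : R)) (fun i => k i + 1)).indicator φ j ∂ν :=
        setLIntegral_le_lintegral _ _
    _ = ∑ k ∈ Finset.Icc (0 : Fin d → ℕ) (fun _ => n),
          ∫⁻ j, (Set.Icc (fun i => (k i : R)) (fun i => k i + 1)).indicator φ j ∂ν :=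
        lintegral_finsetSum _ fun k _ => hφ.indicator (hν.measurableSet_Icc _ _)
    _ ≤ _ := by
        refine Finset.sum_le_sum fun k _ => ?_
        set κ : Fin d → R := fun i => (k i : R)
        have hmI := hν.measurableSet_Icc κ (fun i => k i + 1)
        calc ∫⁻ j, (Set.Icc κ (fun i => k i + 1)).indicator φ j ∂ν
            = ∫⁻ j in Set.Icc κ (fun i => k i + 1),
                (Set.Icc κ (fun i => k i + 1)).indicator φ j ∂ν := by
              rw [lintegral_indicator hmI, setLIntegral_indicator hmI, Set.inter_self]
          _ ≤ ∫⁻ j in Set.Ici κ, (Set.Icc κ (fun i => k i + 1)).indicator φ j ∂ν :=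
              lintegral_mono_set fun j hj => hj.1
          _ = ∫⁻ j in Set.Ici 0, (Set.Icc κ (fun i => k i + 1)).indicator φ (j + κ) ∂ν :=
              (lintegral_Ici_add hν (hcast k) (hφ.indicator hmI)).symm
          _ ≤ ∫⁻ j in Set.Ici 0, (cube R d 1).indicator (fun j => φ (j + κ)) j ∂ν := by
              refine setLIntegral_mono ((hφ.comp (measurable_add_const κ)).indicator (hm 1))
                fun j hj => ?_
              refine Set.indicator_apply_le' (fun hjI => ?_) fun _ => zero_le
              rw [Set.indicator_of_mem]
              refine ⟨hj, fun i => ?_⟩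
              have := hjI.2 i
              simp only [Pi.add_apply, κ] at this
              rw [add_comm] at this
              simpa using le_of_add_le_add_left this
          _ ≤ ∫⁻ j, (cube R d 1).indicator (fun j => φ (j + κ)) j ∂ν :=
              setLIntegral_le_lintegral _ _
          _ = _ := lintegral_indicator (hm 1) _

omit [IsStrictOrderedRing R] [MeasurableAdd R] in
theorem measure_cube_ne_top (hν : IsCubeMeasure ν) (n : ℕ) : ν (cube R d n) ≠ ∞ := by
  obtain ⟨a, ha⟩ := hν.measure_cube
  rw [ha]
  exact ENNReal.pow_ne_top (ENNReal.natCast_ne_top _)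

omit [IsStrictOrderedRing R] [MeasurableAdd R] in
theorem measure_cube_ne_zero (hν : IsCubeMeasure ν) {n : ℕ} (hn : n ≠ 0) :
    ν (cube R d n) ≠ 0 := by
  obtain ⟨a, ha⟩ := hν.measure_cube
  rw [ha]
  simp [hn]

omit [IsStrictOrderedRing R] [MeasurableAdd R] in
theorem tendsto_measure_cube_div (hν : IsCubeMeasure ν) (k : ℕ) :
    Tendsto (fun n => ν (cube R d (n + k)) / ν (cube R d n)) atTop (𝓝 1) := by
  obtain ⟨a, ha⟩ := hν.measure_cube
  have h1 : Tendsto (fun n : ℕ => ((n + k + a : ℕ) : ℝ) / ((n + a : ℕ) : ℝ)) atTop (𝓝 1) := by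
    have h2 : Tendsto (fun n : ℕ => 1 + (k : ℝ) / ((n + a : ℕ) : ℝ)) atTop (𝓝 (1 + 0)) :=
      tendsto_const_nhds.add
        ((tendsto_const_div_atTop_nhds_zero_nat (k : ℝ)).comp (tendsto_add_atTop_nat a))
    rw [add_zero] at h2
    refine h2.congr' ?_
    filter_upwards [eventually_ge_atTop 1] with n hn
    have : ((n : ℝ) + a) ≠ 0 := by positivity
    push_cast
    field_simp
    ring
  have h3 := ENNReal.tendsto_ofReal (h1.pow d)
  simp only [ENNReal.ofReal_one, one_pow] at h3
  refine h3.congr' ?_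
  filter_upwards [eventually_ge_atTop 1] with n hn
  rw [ha, ha, ENNReal.ofReal_pow (by positivity), ENNReal.ofReal_div_of_pos (by positivity),
    ENNReal.ofReal_natCast, ENNReal.ofReal_natCast, ENNReal.div_eq_inv_mul, ENNReal.div_eq_inv_mul,
    mul_pow, ENNReal.inv_pow]

omit [IsStrictOrderedRing R] [MeasurableAdd R] in
theorem pow_le_measure_cube (hν : IsCubeMeasure ν) {n : ℕ} (hn : n ≠ 0) :
    ((n + 1 : ℕ) : ℝ≥0∞) ^ d ≤ 2 ^ d * ν (cube R d n) := by
  obtain ⟨a, ha⟩ := hν.measure_cube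
  rw [ha, ← mul_pow]
  gcongr
  norm_cast
  omega

end Cubes

/-- A one-sided Hardy–Littlewood inequality on `ℕ^d`: if for each `k ∈ E` the sum of `a` over
some cube with least corner `k` is at least `lam` times its size, and these cubes lie in `S`, then
`lam * #E` is at most `2 ^ d` times the sum of `a` over `S`. The proof selects disjoint cubes
greedily, the largest first. -/
theorem mul_card_le_of_cube_sums {d : ℕ} {a : (Fin d → ℕ) → ℝ≥0∞} {lam : ℝ≥0∞}
    {r : (Fin d → ℕ) → ℕ} (E : Finset (Fin d → ℕ)) :
    ∀ S : Finset (Fin d → ℕ),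
    (∀ k ∈ E, lam * ((r k + 1 : ℕ) : ℝ≥0∞) ^ d ≤
      ∑ i ∈ Finset.Icc k (k + fun _ => r k), a i) →
    (∀ k ∈ E, Finset.Icc k (k + fun _ => r k) ⊆ S) →
    lam * E.card ≤ 2 ^ d * ∑ i ∈ S, a i := by
  classical
  induction E using Finset.strongInduction with
  | H E ih =>
    intro S hE hS
    rcases E.eq_empty_or_nonempty with rfl | hne
    · simp
    -- Keep the largest cube `Q k` and discard those that meet it; as they are not larger, their
    -- least corners lie within `r k` of `k` in every coordinate.
    obtain ⟨k, hk, hmax⟩ := E.exists_max_image r hne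
    let Q : (Fin d → ℕ) → Finset (Fin d → ℕ) := fun k => Finset.Icc k (k + fun _ => r k)
    let E' := E.filter fun k' => Disjoint (Q k') (Q k)
    have hkE' : k ∉ E' := by
      intro h
      have := (Finset.mem_filter.1 h).2
      rw [disjoint_self] at this
      have h2 : k ∈ Q k := Finset.mem_Icc.2 ⟨le_rfl, by simp⟩
      simp [this] at h2
    have hlt : E' ⊂ E := Finset.ssubset_iff_subset_ne.2
      ⟨Finset.filter_subset _ _, fun h => hkE' (h ▸ hk)⟩
    have h1 := ih E' hlt (S \ Q k) (fun k' hk' => hE k' (hlt.1 hk')) (fun k' hk' =>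
      Finset.subset_sdiff.2 ⟨hS k' (hlt.1 hk'), (Finset.mem_filter.1 hk').2⟩)
    have hcard : (E \ E').card ≤ (2 * (r k + 1)) ^ d := by
      have hsub : E \ E' ⊆ Finset.Icc (k - fun _ => r k) (k + fun _ => r k) := by
        intro k' hk'
        have hk'E := (Finset.mem_sdiff.1 hk').1
        have hnd : ¬ Disjoint (Q k') (Q k) := fun h =>
          (Finset.mem_sdiff.1 hk').2 (Finset.mem_filter.2 ⟨hk'E, h⟩)
        rw [Finset.not_disjoint_iff] at hnd
        obtain ⟨x, hx', hx⟩ := hnd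
        rw [Finset.mem_Icc] at hx hx' ⊢
        have hr := hmax k' hk'E
        constructor <;> intro i
        · have := hx'.2 i; have := hx.1 i
          simp only [Pi.add_apply, Pi.sub_apply] at *
          omega
        · have := hx'.1 i; have := hx.2 i
          simp only [Pi.add_apply] at *
          omega
      refine (Finset.card_le_card hsub).trans ?_
      rw [Pi.card_Icc]
      refine (Finset.prod_le_pow_card _ _ (2 * (r k + 1)) fun i _ => ?_).trans (by simp)
      simp only [Nat.card_Icc, Pi.add_apply, Pi.sub_apply]
      omega
    have h2 : E.card = E'.card + (E \ E').card := by
      rw [add_comm, Finset.card_sdiff_add_card_eq_card hlt.1]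
    calc lam * E.card = lam * E'.card + lam * (E \ E').card := by rw [h2]; push_cast; ring
      _ ≤ 2 ^ d * ∑ i ∈ S \ Q k, a i + 2 ^ d * ∑ i ∈ Q k, a i := by
          refine add_le_add h1 ?_
          calc lam * (E \ E').card ≤ lam * ((2 * (r k + 1)) ^ d : ℕ) := by gcongr
            _ = 2 ^ d * (lam * ((r k + 1 : ℕ) : ℝ≥0∞) ^ d) := by push_cast; rw [mul_pow]; ring
            _ ≤ _ := by gcongr; exact hE k hk
      _ = 2 ^ d * ∑ i ∈ S, a i := by
          rw [← mul_add, Finset.sum_sdiff (hS k hk)]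

/-! ### The maximal inequality -/

section Maximal

variable {R : Type*} [CommSemiring R] [PartialOrder R] [IsStrictOrderedRing R] [MeasurableSpace R]
  [MeasurableAdd R] {d : ℕ} {ν : Measure (Fin d → R)} {Y : Type*} [MeasurableSpace Y]
  {m : Measure Y} {T : (Fin d → R) → Y → Y}

/-- The average of `φ` over the orbit piece `T j y`, `j ∈ F_n`. -/
noncomputable def orbitAverage (ν : Measure (Fin d → R)) (T : (Fin d → R) → Y → Y) (n : ℕ)
    (φ : Y → ℝ≥0∞) (y : Y) : ℝ≥0∞ :=
  cubeAverage ν n fun j => φ (T j y)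

omit [PartialOrder R] [IsStrictOrderedRing R] [MeasurableAdd R] in
theorem IsMPS.measurable_comp_orbit (hT : IsMPS m T) {φ : Y → ℝ≥0∞} (hφ : Measurable φ) (y : Y) :
    Measurable fun j => φ (T j y) :=
  hφ.comp (hT.measurable_uncurry.comp (measurable_id.prodMk measurable_const))

omit [IsStrictOrderedRing R] [MeasurableAdd R] in
theorem measurable_lintegral_orbit [SFinite ν] (hT : IsMPS m T) {φ : Y → ℝ≥0∞}
    (hφ : Measurable φ) (n : ℕ) : Measurable fun y => ∫⁻ j in cube R d n, φ (T j y) ∂ν :=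
  (hφ.comp hT.measurable_uncurry).lintegral_prod_left'
    (f := fun p : (Fin d → R) × Y => φ (T p.1 p.2))

omit [IsStrictOrderedRing R] [MeasurableAdd R] in
theorem measurable_orbitAverage [SFinite ν] (hT : IsMPS m T) {φ : Y → ℝ≥0∞}
    (hφ : Measurable φ) (n : ℕ) : Measurable (orbitAverage ν T n φ) :=
  (measurable_lintegral_orbit hT hφ n).div_const _

omit [IsStrictOrderedRing R] [MeasurableAdd R] in
theorem lintegral_lintegral_orbit [SFinite ν] [SFinite m] (hT : IsMPS m T) {φ : Y → ℝ≥0∞}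
    (hφ : Measurable φ) (n : ℕ) :
    ∫⁻ y, ∫⁻ j in cube R d n, φ (T j y) ∂ν ∂m = ν (cube R d n) * ∫⁻ y, φ y ∂m := by
  rw [lintegral_lintegral_swap]
  · simp_rw [fun j => (hT.measurePreserving j).lintegral_comp hφ]
    rw [setLIntegral_const, mul_comm]
  · exact ((hφ.comp hT.measurable_uncurry).comp measurable_swap).aemeasurable

omit [IsStrictOrderedRing R] [MeasurableAdd R] in
theorem lintegral_orbitAverage (hν : IsCubeMeasure ν) [SFinite m] (hT : IsMPS m T) {φ : Y → ℝ≥0∞}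
    (hφ : Measurable φ) {n : ℕ} (hn : n ≠ 0) :
    ∫⁻ y, orbitAverage ν T n φ y ∂m = ∫⁻ y, φ y ∂m := by
  have := hν.sFinite
  simp only [orbitAverage, cubeAverage, ENNReal.div_eq_inv_mul]
  rw [lintegral_const_mul _ (measurable_lintegral_orbit hT hφ n),
    lintegral_lintegral_orbit hT hφ, ← mul_assoc,
    ENNReal.inv_mul_cancel (measure_cube_ne_zero hν hn) (measure_cube_ne_top hν n), one_mul]

/-- The weak type `(1, 1)` maximal inequality, with a constant that depends on the time semigroup
only. -/
theorem exists_weak_type_maximal (hν : IsCubeMeasure ν) :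
    ∃ C : ℝ≥0∞, C ≠ ∞ ∧ ∀ {Y : Type*} [MeasurableSpace Y] {m : Measure Y} [SFinite m]
      {T : (Fin d → R) → Y → Y}, IsMPS m T → ∀ {φ : Y → ℝ≥0∞}, Measurable φ → ∀ lam : ℝ≥0∞,
      lam * m {y | ∃ n, n ≠ 0 ∧ lam < orbitAverage ν T n φ y} ≤ C * ∫⁻ y, φ y ∂m := by
  have := hν.sFinite
  refine ⟨8 ^ d * ν (cube R d 1), ENNReal.mul_ne_top (by simp) (measure_cube_ne_top hν 1), ?_⟩
  intro Y _ m _ T hT φ hφ lam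
  -- It suffices to bound the measure of the sets `EN N`, where the lengths are at most `N`.
  let EN : ℕ → Set Y := fun N => {y | ∃ n, n ≤ N ∧ n ≠ 0 ∧ lam < orbitAverage ν T n φ y}
  have hEN : ∀ N, MeasurableSet (EN N) := by
    intro N
    have : EN N = ⋃ n, ⋃ (_ : n ≤ N ∧ n ≠ 0), {y | lam < orbitAverage ν T n φ y} := by
      ext y; simp [EN, and_assoc]
    rw [this]
    exact MeasurableSet.iUnion fun n => MeasurableSet.iUnion fun _ =>
      measurableSet_lt measurable_const (measurable_orbitAverage hT hφ n)
  have hunion : {y | ∃ n, n ≠ 0 ∧ lam < orbitAverage ν T n φ y} = ⋃ N, EN N := by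
    ext y
    simp only [EN, Set.mem_ofPred_eq, Set.mem_iUnion]
    exact ⟨fun ⟨n, h⟩ => ⟨n, n, le_rfl, h⟩, fun ⟨_, n, _, h⟩ => ⟨n, h⟩⟩
  have hmono : Monotone EN := fun a b hab y ⟨n, hn, h⟩ => ⟨n, hn.trans hab, h⟩
  rw [hunion, hmono.measure_iUnion, ENNReal.mul_iSup]
  refine iSup_le fun N => ?_
  let S : (Fin d → ℕ) → Y → Y := fun k => T fun i => (k i : R)
  have hS : ∀ k l y, S (k + l) y = S l (S k y) := by
    intro k l y
    simp only [S]
    rw [← hT.map_add]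
    congr 1
    ext i
    simp [add_comm]
  let Φ : Y → ℝ≥0∞ := fun y => ∫⁻ j in cube R d 1, φ (T j y) ∂ν
  have hΦ : Measurable Φ := measurable_lintegral_orbit hT hφ 1
  have hS' : ∀ k, MeasurePreserving (S k) m m := fun k => hT.measurePreserving _
  -- on `EN N` some average of `Φ` over a discrete cube is large
  have key : ∀ y ∈ EN N, ∃ r, r ≤ N ∧ lam * ((r + 1 : ℕ) : ℝ≥0∞) ^ d ≤
      ∑ i ∈ Finset.Icc 0 (fun _ => r), 2 ^ d * Φ (S i y) := by
    rintro y ⟨n, hnN, hn0, hn⟩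
    refine ⟨n, hnN, ?_⟩
    rw [← Finset.mul_sum]
    have h1 := lintegral_cube_le_sum hν n (hT.measurable_comp_orbit hφ y)
    have h2 : lam * ν (cube R d n) ≤ ∫⁻ j in cube R d n, φ (T j y) ∂ν :=
      ((ENNReal.lt_div_iff_mul_lt (.inl (measure_cube_ne_zero hν hn0))
        (.inl (measure_cube_ne_top hν n))).1 hn).le
    calc lam * ((n + 1 : ℕ) : ℝ≥0∞) ^ d ≤ lam * (2 ^ d * ν (cube R d n)) := by
          gcongr; exact pow_le_measure_cube hν hn0
      _ = 2 ^ d * (lam * ν (cube R d n)) := by ring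
      _ ≤ _ := by
          gcongr
          refine h2.trans (h1.trans (le_of_eq ?_))
          simp only [Φ, S, hT.map_add]
  -- Apply the covering lemma to the visits of the orbit of `y` to `EN N` during `[0, N]^d`; the
  -- cubes that it involves lie in `[0, 2 N]^d`.
  have pw : ∀ y, ∑ k ∈ Finset.Icc 0 (fun _ : Fin d => N),
      lam * (S k ⁻¹' EN N).indicator (1 : Y → ℝ≥0∞) y ≤
      ∑ i ∈ Finset.Icc 0 (fun _ : Fin d => 2 * N), 4 ^ d * Φ (S i y) := by
    classical
    intro y
    let E := (Finset.Icc 0 (fun _ : Fin d => N)).filter fun k => S k y ∈ EN N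
    have hex : ∀ k : Fin d → ℕ, ∃ r, r ≤ N ∧ (S k y ∈ EN N → lam * ((r + 1 : ℕ) : ℝ≥0∞) ^ d ≤
      ∑ i ∈ Finset.Icc 0 (fun _ => r), 2 ^ d * Φ (S i (S k y))) := by
      intro k
      by_cases h : S k y ∈ EN N
      · obtain ⟨r, h1, h2⟩ := key _ h
        exact ⟨r, h1, fun _ => h2⟩
      · exact ⟨0, zero_le, fun h' => (h h').elim⟩
    choose r hrN hr using hex
    have h := mul_card_le_of_cube_sums (a := fun i => 2 ^ d * Φ (S i y)) (lam := lam) (r := r) E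
      (Finset.Icc 0 (fun _ : Fin d => 2 * N)) (fun k hk => by
        refine (hr k (Finset.mem_filter.1 hk).2).trans (le_of_eq ?_)
        have : Finset.Icc k (k + fun _ => r k) =
            (Finset.Icc 0 (fun _ => r k)).map (addLeftEmbedding k) := by
          rw [Finset.map_add_left_Icc, add_zero]
        rw [this, Finset.sum_map]
        simp only [addLeftEmbedding_apply, hS]) (fun k hk => by
        refine Finset.Icc_subset_Icc (fun _ => Nat.zero_le _) fun i => ?_
        have h1 := (Finset.mem_Icc.1 (Finset.mem_filter.1 hk).1).2 i
        have h2 := hrN k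
        simp only [Pi.add_apply] at *
        omega)
    calc ∑ k ∈ Finset.Icc 0 (fun _ : Fin d => N),
          lam * (S k ⁻¹' EN N).indicator (1 : Y → ℝ≥0∞) y = lam * E.card := by
          rw [← Finset.mul_sum, Finset.card_filter]
          push_cast
          congr 1
          refine Finset.sum_congr rfl fun k _ => ?_
          simp [Set.indicator_apply]
      _ ≤ _ := h
      _ = _ := by
          rw [Finset.mul_sum]
          refine Finset.sum_congr rfl fun i _ => ?_
          rw [← mul_assoc, ← mul_pow]
          norm_num
  -- Integrating over `y`, invariance turns the left side into `(N + 1)^d * lam * m (EN N)`.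
  have hint := lintegral_mono (μ := m) pw
  rw [lintegral_finsetSum _ (f := fun k y => lam * (S k ⁻¹' EN N).indicator (1 : Y → ℝ≥0∞) y)
      fun k _ => (measurable_const.mul (measurable_one.indicator ((hS' k).measurable (hEN N)))),
    lintegral_finsetSum _ (f := fun i y => 4 ^ d * Φ (S i y))
      fun k _ => measurable_const.mul (hΦ.comp (hS' k).measurable)] at hint
  have e1 : ∀ k, ∫⁻ y, lam * (S k ⁻¹' EN N).indicator (1 : Y → ℝ≥0∞) y ∂m = lam * m (EN N) := by
    intro k
    rw [lintegral_const_mul _ (measurable_one.indicator ((hS' k).measurable (hEN N))),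
      lintegral_indicator_one ((hS' k).measurable (hEN N)),
      (hS' k).measure_preimage (hEN N).nullMeasurableSet]
  have e2 : ∀ k, ∫⁻ y, 4 ^ d * Φ (S k y) ∂m = 4 ^ d * (ν (cube R d 1) * ∫⁻ y, φ y ∂m) := by
    intro k
    rw [lintegral_const_mul (f := fun y => Φ (S k y)) _ (hΦ.comp (hS' k).measurable),
      (hS' k).lintegral_comp hΦ,
      lintegral_lintegral_orbit hT hφ]
  simp only [e1, e2, Finset.sum_const, Pi.card_Icc, nsmul_eq_mul] at hint
  simp only [Pi.zero_apply, Nat.card_Icc, Finset.prod_const, Finset.card_univ, Fintype.card_fin,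
    tsub_zero, Nat.cast_pow] at hint
  have hpos : ((N + 1 : ℕ) : ℝ≥0∞) ^ d ≠ 0 := by simp
  have htop : ((N + 1 : ℕ) : ℝ≥0∞) ^ d ≠ ∞ := ENNReal.pow_ne_top (ENNReal.natCast_ne_top _)
  rw [← ENNReal.mul_le_mul_iff_right hpos htop]
  refine hint.trans ?_
  calc ((2 * N + 1 : ℕ) : ℝ≥0∞) ^ d * (4 ^ d * (ν (cube R d 1) * ∫⁻ y, φ y ∂m))
      ≤ (2 * ((N + 1 : ℕ) : ℝ≥0∞)) ^ d * (4 ^ d * (ν (cube R d 1) * ∫⁻ y, φ y ∂m)) := by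
        gcongr
        norm_cast
        omega
    _ = _ := by
        rw [mul_pow, show (8 : ℝ≥0∞) ^ d = 2 ^ d * 4 ^ d by rw [← mul_pow]; norm_num]
        ring

end Maximal

/-! ### Orbit averages and approximation -/

section Convergence

variable {R : Type*} [CommSemiring R] [PartialOrder R] [IsStrictOrderedRing R] [MeasurableSpace R]
  [MeasurableAdd R] {d : ℕ} {ν : Measure (Fin d → R)} {Y : Type*} [MeasurableSpace Y]
  {m : Measure Y} {T : (Fin d → R) → Y → Y}

omit [IsStrictOrderedRing R] [MeasurableAdd R] in
theorem orbitAverage_add (hT : IsMPS m T) {φ : Y → ℝ≥0∞} (hφ : Measurable φ) (ψ : Y → ℝ≥0∞)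
    (n : ℕ) (y : Y) :
    orbitAverage ν T n (fun z => φ z + ψ z) y =
      orbitAverage ν T n φ y + orbitAverage ν T n ψ y := by
  simp only [orbitAverage, cubeAverage]
  rw [lintegral_add_left (hT.measurable_comp_orbit hφ y), ENNReal.add_div]

omit [IsStrictOrderedRing R] [MeasurableAdd R] in
theorem orbitAverage_const_mul (hT : IsMPS m T) {φ : Y → ℝ≥0∞} (hφ : Measurable φ) (c : ℝ≥0∞)
    (n : ℕ) (y : Y) :
    orbitAverage ν T n (fun z => c * φ z) y = c * orbitAverage ν T n φ y := by
  simp only [orbitAverage, cubeAverage]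
  rw [lintegral_const_mul _ (hT.measurable_comp_orbit hφ y), mul_div_assoc]

omit [IsStrictOrderedRing R] [MeasurableAdd R] [MeasurableSpace Y] in
theorem orbitAverage_mono {φ ψ : Y → ℝ≥0∞} (h : ∀ y, φ y ≤ ψ y) (n : ℕ) (y : Y) :
    orbitAverage ν T n φ y ≤ orbitAverage ν T n ψ y :=
  ENNReal.div_le_div_right (lintegral_mono fun _ => h _) _

omit [MeasurableSpace Y] in
omit [IsStrictOrderedRing R] [MeasurableAdd R] in
theorem orbitAverage_const (hν : IsCubeMeasure ν) (c : ℝ≥0∞) {n : ℕ} (hn : n ≠ 0) (y : Y) :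
    orbitAverage ν T n (fun _ => c) y = c := by
  simp only [orbitAverage, cubeAverage]
  rw [setLIntegral_const, mul_div_assoc,
    ENNReal.div_self (measure_cube_ne_zero hν hn) (measure_cube_ne_top hν n), mul_one]

omit [MeasurableSpace Y] in
omit [IsStrictOrderedRing R] [MeasurableAdd R] in
theorem orbitAverage_le (hν : IsCubeMeasure ν) {c : ℝ≥0∞} {φ : Y → ℝ≥0∞} (h : ∀ y, φ y ≤ c)
    {n : ℕ} (hn : n ≠ 0) (y : Y) : orbitAverage ν T n φ y ≤ c :=
  (orbitAverage_mono h n y).trans_eq (orbitAverage_const hν c hn y)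

omit [PartialOrder R] [IsStrictOrderedRing R] [MeasurableAdd R] in
theorem ae_ae_orbit [SFinite ν] [SFinite m] (hT : IsMPS m T) {p : Y → Prop} (hp : ∀ᵐ y ∂m, p y) :
    ∀ᵐ y ∂m, ∀ᵐ j ∂ν, p (T j y) := by
  obtain ⟨N, hN, hNm, hN0⟩ := exists_measurable_superset_of_null (ae_iff.1 hp)
  have h : ∀ᵐ y ∂m, ∀ᵐ j ∂ν, T j y ∉ N := by
    rw [← Measure.ae_ae_comm (p := fun j y => T j y ∉ N) (hT.measurable_uncurry hNm.compl)]
    exact ae_of_all _ fun j => (hT.measurePreserving j).quasiMeasurePreserving.ae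
      (measure_eq_zero_iff_ae_notMem.1 hN0)
  filter_upwards [h] with y hy
  filter_upwards [hy] with j hj
  by_contra h
  exact hj (hN h)

omit [IsStrictOrderedRing R] [MeasurableAdd R] in
theorem ae_orbitAverage_le [SFinite ν] [SFinite m] (hT : IsMPS m T) {φ ψ : Y → ℝ≥0∞}
    (h : ∀ᵐ y ∂m, φ y ≤ ψ y) :
    ∀ᵐ y ∂m, ∀ n, orbitAverage ν T n φ y ≤ orbitAverage ν T n ψ y := by
  filter_upwards [ae_ae_orbit (ν := ν) hT h] with y hy n
  exact ENNReal.div_le_div_right (lintegral_mono_ae (ae_restrict_of_ae hy)) _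

omit [IsStrictOrderedRing R] [MeasurableAdd R] in
/-- Invariance under each `T s` up to an `s`-dependent null set suffices for the averages of `φ` to
be equal to `φ` almost everywhere. -/
theorem ae_orbitAverage_eq_self (hν : IsCubeMeasure ν) [SFinite m] (hT : IsMPS m T)
    {φ : Y → ℝ≥0∞} (hφ : Measurable φ) (h : ∀ s, 0 ≤ s → ∀ᵐ y ∂m, φ (T s y) = φ y) :
    ∀ᵐ y ∂m, ∀ n, n ≠ 0 → orbitAverage ν T n φ y = φ y := by
  have := hν.sFinite
  refine ae_all_iff.2 fun n => ?_
  have h1 : ∀ᵐ y ∂m, ∀ᵐ j ∂ν.restrict (cube R d n), φ (T j y) = φ y := by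
    rw [← Measure.ae_ae_comm (p := fun j y => φ (T j y) = φ y)
      (measurableSet_eq_fun (hφ.comp hT.measurable_uncurry) (hφ.comp measurable_snd))]
    filter_upwards [ae_restrict_mem (hν.measurableSet_cube n)] with j hj
    exact h j hj.1
  filter_upwards [h1] with y hy hn
  rw [← orbitAverage_const (T := T) hν (φ y) hn y]
  simp only [orbitAverage, cubeAverage]
  rw [lintegral_congr_ae hy]

/-- For bounded `φ` the averages of `φ ∘ T s` and of `φ` differ by a quantity that tends to `0`
uniformly. This is the upper bound; the lower bound `eventually_le_orbitAverage_comp` results from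
applying it to `c - φ`. -/
theorem eventually_orbitAverage_comp_le (hν : IsCubeMeasure ν) (hT : IsMPS m T) {c : ℝ≥0}
    {φ : Y → ℝ≥0∞} (hφ : Measurable φ) (hc : ∀ y, φ y ≤ c) {s : Fin d → R} (hs : 0 ≤ s)
    {t : ℝ≥0∞} (ht : t ≠ 0) :
    ∀ᶠ n in atTop, ∀ y,
      orbitAverage ν T n (fun z => φ (T s z)) y ≤ orbitAverage ν T n φ y + t := by
  obtain ⟨k, hk⟩ := exists_lintegral_cube_add_le hν hs
  have h1 : Tendsto (fun n => (c : ℝ≥0∞) * (ν (cube R d (n + k)) / ν (cube R d n) - 1)) atTop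
      (𝓝 (c * (1 - 1))) :=
    ENNReal.Tendsto.const_mul (ENNReal.Tendsto.sub (tendsto_measure_cube_div hν k)
      tendsto_const_nhds (.inl ENNReal.one_ne_top)) (.inr ENNReal.coe_ne_top)
  rw [tsub_self, mul_zero] at h1
  filter_upwards [h1.eventually_lt_const (pos_iff_ne_zero.2 ht), eventually_ne_atTop 0]
    with n hn hn0 y
  have h0 := measure_cube_ne_zero hν hn0
  have hF := measure_cube_ne_top hν n
  have e1 : ∫⁻ j in cube R d n, φ (T s (T j y)) ∂ν ≤ ∫⁻ j in cube R d (n + k), φ (T j y) ∂ν := by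
    refine le_trans (le_of_eq ?_) (hk n _ (hT.measurable_comp_orbit hφ y))
    simp only [add_comm _ s, hT.map_add]
  have e2 : ∫⁻ j in cube R d (n + k), φ (T j y) ∂ν ≤
      ∫⁻ j in cube R d n, φ (T j y) ∂ν + c * (ν (cube R d (n + k)) - ν (cube R d n)) := by
    have hsub := cube_mono (R := R) (d := d) (Nat.le_add_right n k)
    rw [← measure_sdiff hsub (hν.measurableSet_cube n).nullMeasurableSet hF]
    conv_lhs => rw [← Set.union_sdiff_cancel hsub]
    refine (lintegral_union_le _ _ _).trans (add_le_add le_rfl ?_)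
    rw [← setLIntegral_const]
    exact lintegral_mono fun j => hc _
  calc orbitAverage ν T n (fun z => φ (T s z)) y
      ≤ (∫⁻ j in cube R d n, φ (T j y) ∂ν + c * (ν (cube R d (n + k)) - ν (cube R d n))) /
          ν (cube R d n) := ENNReal.div_le_div_right (e1.trans e2) _
    _ = orbitAverage ν T n φ y + c * (ν (cube R d (n + k)) / ν (cube R d n) - 1) := by
        rw [ENNReal.add_div, mul_div_assoc, ENNReal.sub_div (fun _ _ => h0),
          ENNReal.div_self h0 hF]
        rfl
    _ ≤ _ := by gcongr

theorem eventually_le_orbitAverage_comp (hν : IsCubeMeasure ν) (hT : IsMPS m T) {c : ℝ≥0}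
    {φ : Y → ℝ≥0∞} (hφ : Measurable φ) (hc : ∀ y, φ y ≤ c) {s : Fin d → R} (hs : 0 ≤ s)
    {t : ℝ≥0∞} (ht : t ≠ 0) :
    ∀ᶠ n in atTop, ∀ y,
      orbitAverage ν T n φ y ≤ orbitAverage ν T n (fun z => φ (T s z)) y + t := by
  have hψ : Measurable fun y => (c : ℝ≥0∞) - φ y := measurable_const.sub hφ
  filter_upwards [eventually_orbitAverage_comp_le hν hT (c := c) hψ (fun y => tsub_le_self) hs ht,
    eventually_ne_atTop 0] with n hn hn0 y
  have hs' := (hT.measurePreserving s).measurable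
  have e1 : orbitAverage ν T n φ y + orbitAverage ν T n (fun y => (c : ℝ≥0∞) - φ y) y = c := by
    rw [← orbitAverage_add hT hφ]
    simp only [add_tsub_cancel_of_le (hc _)]
    exact orbitAverage_const hν _ hn0 y
  have e2 : orbitAverage ν T n (fun z => φ (T s z)) y +
      orbitAverage ν T n (fun y => (c : ℝ≥0∞) - φ (T s y)) y = c := by
    rw [← orbitAverage_add (φ := fun z => φ (T s z)) hT (hφ.comp hs')]
    simp only [add_tsub_cancel_of_le (hc _)]
    exact orbitAverage_const hν _ hn0 y
  have hfin : orbitAverage ν T n (fun y => (c : ℝ≥0∞) - φ (T s y)) y ≠ ∞ :=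
    ne_top_of_le_ne_top ENNReal.coe_ne_top (orbitAverage_le hν (fun y => tsub_le_self) hn0 y)
  refine (ENNReal.add_le_add_iff_right hfin).1 ?_
  calc _ ≤ orbitAverage ν T n φ y + (orbitAverage ν T n (fun y => (c : ℝ≥0∞) - φ y) y + t) := by
        gcongr; exact hn y
    _ = c + t := by rw [← add_assoc, e1]
    _ = _ := by rw [add_right_comm, e2]

/-- Banach's principle: by the maximal inequality, almost everywhere convergence of averages is
preserved under approximation with errors `r` that are small in `L¹`, and under asymptotically
negligible changes of the averages. -/
theorem ae_tendsto_of_approx (hν : IsCubeMeasure ν) [SFinite m] (hT : IsMPS m T)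
    {φ : Y → ℝ≥0∞}
    (happ : ∀ η : ℝ≥0∞, η ≠ 0 → ∃ ψ r : Y → ℝ≥0∞, Measurable r ∧ ∫⁻ y, r y ∂m ≤ η ∧
      (∀ᵐ y ∂m, ∃ l, Tendsto (fun n => orbitAverage ν T n ψ y) atTop (𝓝 l)) ∧
      ∀ᵐ y ∂m, ∀ t : ℝ≥0∞, t ≠ 0 → ∀ᶠ n in atTop,
        orbitAverage ν T n φ y ≤ orbitAverage ν T n ψ y + orbitAverage ν T n r y + t ∧
        orbitAverage ν T n ψ y ≤ orbitAverage ν T n φ y + orbitAverage ν T n r y + t) :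
    ∀ᵐ y ∂m, ∃ l, Tendsto (fun n => orbitAverage ν T n φ y) atTop (𝓝 l) := by
  obtain ⟨C, hC, hmax⟩ := exists_weak_type_maximal hν
  have main : ∀ k : ℕ, ∀ᵐ y ∂m, limsup (fun n => orbitAverage ν T n φ y) atTop ≤
      liminf (fun n => orbitAverage ν T n φ y) atTop + 4 * ((k + 1 : ℕ) : ℝ≥0∞)⁻¹ := by
    intro k
    set lam : ℝ≥0∞ := ((k + 1 : ℕ) : ℝ≥0∞)⁻¹ with hlam
    have hlam0 : lam ≠ 0 := ENNReal.inv_ne_zero.2 (ENNReal.natCast_ne_top _)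
    have hlamt : lam ≠ ∞ := ENNReal.inv_ne_top.2 (by simp)
    rw [ae_iff]
    set B := {y | ¬ limsup (fun n => orbitAverage ν T n φ y) atTop ≤
      liminf (fun n => orbitAverage ν T n φ y) atTop + 4 * lam}
    -- Outside `{sup A_n r > lam}` the averages of `φ` are eventually within `2 * lam` of a
    -- convergent sequence, hence oscillate by at most `4 * lam`.
    have hB : ∀ η : ℝ≥0∞, η ≠ 0 → lam * m B ≤ C * η := by
      intro η hη
      obtain ⟨ψ, r, hr, hrη, hψ, hψr⟩ := happ η hη
      refine le_trans ?_ ((hmax hT hr lam).trans (by gcongr))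
      refine mul_le_mul' le_rfl (measure_mono_ae ?_)
      filter_upwards [hψ, hψr] with y ⟨l, hl⟩ hy hyB
      by_contra hcon
      have hcon' : ∀ n, n ≠ 0 → orbitAverage ν T n r y ≤ lam := by
        intro n hn
        by_contra h
        exact hcon ⟨n, hn, not_le.1 h⟩
      refine hyB ?_
      have hev : ∀ᶠ n in atTop,
          orbitAverage ν T n φ y ≤ orbitAverage ν T n ψ y + 2 * lam ∧
          orbitAverage ν T n ψ y ≤ orbitAverage ν T n φ y + 2 * lam := by
        filter_upwards [hy lam hlam0, eventually_ne_atTop 0] with n ⟨h1, h2⟩ hn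
        have := hcon' n hn
        rw [two_mul, ← add_assoc, ← add_assoc]
        exact ⟨h1.trans (by gcongr), h2.trans (by gcongr)⟩
      have up : limsup (fun n => orbitAverage ν T n φ y) atTop ≤ l + 2 * lam := by
        rw [← (hl.add tendsto_const_nhds).limsup_eq]
        exact limsup_le_limsup (hev.mono fun n h => h.1)
      have lo : l - 2 * lam ≤ liminf (fun n => orbitAverage ν T n φ y) atTop := by
        rw [← (ENNReal.Tendsto.sub hl tendsto_const_nhds
          (.inr (ENNReal.mul_ne_top (by simp) hlamt))).liminf_eq]
        exact liminf_le_liminf (hev.mono fun n h => tsub_le_iff_right.2 h.2)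
      calc _ ≤ _ := up
        _ ≤ _ := add_le_add (tsub_le_iff_right.1 lo) le_rfl
        _ = _ := by ring
    have hz : lam * m B = 0 := by
      refine nonpos_iff_eq_zero.1 (le_of_forall_gt fun c hc => ?_)
      obtain ⟨η, hη0, hη⟩ : ∃ η : ℝ≥0∞, η ≠ 0 ∧ C * η < c := by
        have : Tendsto (fun n : ℕ => C * ((n : ℝ≥0∞))⁻¹) atTop (𝓝 (C * 0)) :=
          ENNReal.Tendsto.const_mul ENNReal.tendsto_inv_nat_nhds_zero (.inr hC)
        rw [mul_zero] at this
        obtain ⟨n, hn⟩ := (this.eventually_lt_const hc).exists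
        exact ⟨_, ENNReal.inv_ne_zero.2 (ENNReal.natCast_ne_top n), hn⟩
      exact (hB η hη0).trans_lt hη
    exact (mul_eq_zero.1 hz).resolve_left hlam0
  filter_upwards [ae_all_iff.2 main] with y hy
  refine ⟨_, tendsto_of_le_liminf_of_limsup_le le_rfl ?_⟩
  have : Tendsto (fun k : ℕ => liminf (fun n => orbitAverage ν T n φ y) atTop +
      4 * ((k + 1 : ℕ) : ℝ≥0∞)⁻¹) atTop
      (𝓝 (liminf (fun n => orbitAverage ν T n φ y) atTop + 4 * 0)) :=
    tendsto_const_nhds.add (ENNReal.Tendsto.const_mul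
      (ENNReal.tendsto_inv_nat_nhds_zero.comp (tendsto_add_atTop_nat 1)) (.inr (by simp)))
  rw [mul_zero, add_zero] at this
  exact ge_of_tendsto' this hy

end Convergence

/-! ### The pointwise ergodic theorem -/

section Ergodic

variable {R : Type*} [CommSemiring R] [PartialOrder R] [IsStrictOrderedRing R] [MeasurableSpace R]
  [MeasurableAdd R] {d : ℕ} {ν : Measure (Fin d → R)} {Y : Type*} [MeasurableSpace Y]
  {m : Measure Y} {T : (Fin d → R) → Y → Y}

omit [MeasurableAdd R] in
/-- The closed convex hull of the orbit of `f` under the isometries `U^s`, `s ≥ 0`, is mapped into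
itself by them, so its element of minimal norm is invariant. -/
theorem exists_invariant_mem_closure_convexHull [IsProbabilityMeasure m] (hT : IsMPS m T)
    (f : Lp ℝ 2 m) :
    ∃ g ∈ closure (convexHull ℝ (Set.range fun s : Set.Ici (0 : Fin d → R) =>
        Lp.compMeasurePreservingₗᵢ ℝ (T s) (hT.measurePreserving s) f)),
      ∀ s, 0 ≤ s → Lp.compMeasurePreservingₗᵢ ℝ (T s) (hT.measurePreserving s) g = g := by
  set U : (Fin d → R) → Lp ℝ 2 m →ₗᵢ[ℝ] Lp ℝ 2 m := fun s =>
    Lp.compMeasurePreservingₗᵢ ℝ (T s) (hT.measurePreserving s) with hU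
  set O : Set (Lp ℝ 2 m) := Set.range fun s : Set.Ici (0 : Fin d → R) => U s f with hO
  have hconv : Convex ℝ (closure (convexHull ℝ O)) := (convex_convexHull ℝ O).closure
  have hne : (closure (convexHull ℝ O)).Nonempty :=
    ⟨U 0 f, subset_closure (subset_convexHull ℝ O ⟨⟨0, Set.mem_Ici.2 le_rfl⟩, rfl⟩)⟩
  obtain ⟨g, hg, hmin⟩ := exists_norm_eq_iInf_of_complete_convex hne
    isClosed_closure.isComplete hconv 0
  rw [norm_eq_iInf_iff_real_inner_le_zero hconv hg] at hmin
  have hcomp : ∀ s t : Fin d → R, U s (U t f) = U (t + s) f := by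
    intro s t
    refine Lp.ext ?_
    refine (Lp.coeFn_compMeasurePreserving _ _).trans ?_
    refine EventuallyEq.trans ?_ (Lp.coeFn_compMeasurePreserving _ _).symm
    have := (hT.measurePreserving s).quasiMeasurePreserving.ae_eq
      (Lp.coeFn_compMeasurePreserving f (hT.measurePreserving t))
    refine this.trans (Eventually.of_forall fun y => ?_)
    simp [hT.map_add]
  refine ⟨g, hg, fun s hs => ?_⟩
  have hmaps : U s g ∈ closure (convexHull ℝ O) := by
    refine map_mem_closure (U s).continuous hg fun u hu => ?_
    have h1 : U s u ∈ (U s).toLinearMap '' convexHull ℝ O := ⟨u, hu, rfl⟩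
    rw [LinearMap.image_convexHull] at h1
    refine convexHull_mono ?_ h1
    rintro _ ⟨_, ⟨⟨t, ht⟩, rfl⟩, rfl⟩
    exact ⟨⟨t + s, add_nonneg ht hs⟩, (hcomp s t).symm⟩
  have h1 := hmin _ hmaps
  have h2 : ‖U s g - g‖ ^ 2 = 2 * inner ℝ (0 - g) (U s g - g) := by
    rw [norm_sub_sq_real, (U s).norm_map, zero_sub, inner_neg_left, inner_sub_right,
      real_inner_self_eq_norm_sq, real_inner_comm]
    ring
  -- Minimality gives `⟪0 - g, U s g - g⟫ ≤ 0`.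
  have h3 : ‖U s g - g‖ ^ 2 = 0 := le_antisymm (by rw [h2]; linarith) (sq_nonneg _)
  exact sub_eq_zero.1 (norm_eq_zero.1 (pow_eq_zero_iff two_ne_zero |>.1 h3))

theorem ae_tendsto_orbitAverage_of_bounded (hν : IsCubeMeasure ν) [IsProbabilityMeasure m]
    (hT : IsMPS m T) {c : ℝ≥0} {φ : Y → ℝ≥0∞} (hφ : Measurable φ) (hc : ∀ y, φ y ≤ c) :
    ∀ᵐ y ∂m, ∃ l, Tendsto (fun n => orbitAverage ν T n φ y) atTop (𝓝 l) := by
  have := hν.sFinite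
  have hfL : MemLp (fun y => (φ y).toReal) 2 m :=
    MemLp.of_bound hφ.ennreal_toReal.aestronglyMeasurable c (Eventually.of_forall fun y => by
      rw [Real.norm_of_nonneg ENNReal.toReal_nonneg]
      exact ENNReal.toReal_mono ENNReal.coe_ne_top (hc y))
  obtain ⟨g, hg, hinv⟩ := exists_invariant_mem_closure_convexHull hT (hfL.toLp _)
  -- `P` is a convex set of functions whose averages are uniformly asymptotic to those of `φ`.
  set P : Set (Lp ℝ 2 m) := {u | (∀ᵐ y ∂m, 0 ≤ u y) ∧ ∃ v : Y → ℝ≥0∞, Measurable v ∧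
    (∀ᵐ y ∂m, v y = ENNReal.ofReal (u y)) ∧ ∀ t : ℝ≥0∞, t ≠ 0 → ∀ᶠ n in atTop, ∀ y,
      orbitAverage ν T n φ y ≤ orbitAverage ν T n v y + t ∧
      orbitAverage ν T n v y ≤ orbitAverage ν T n φ y + t} with hP
  have hPorb : ∀ s : Fin d → R, 0 ≤ s →
      Lp.compMeasurePreservingₗᵢ ℝ (T s) (hT.measurePreserving s) (hfL.toLp _) ∈ P := by
    intro s hs
    have h1 : ∀ᵐ y ∂m, Lp.compMeasurePreservingₗᵢ ℝ (T s) (hT.measurePreserving s) (hfL.toLp _) y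
        = (φ (T s y)).toReal := by
      filter_upwards [Lp.coeFn_compMeasurePreserving (hfL.toLp _) (hT.measurePreserving s),
        (hT.measurePreserving s).quasiMeasurePreserving.ae hfL.coeFn_toLp] with y h1 h2
      exact h1.trans h2
    refine ⟨?_, fun y => φ (T s y), hφ.comp (hT.measurePreserving s).measurable, ?_, ?_⟩
    · filter_upwards [h1] with y hy
      rw [hy]; exact ENNReal.toReal_nonneg
    · filter_upwards [h1] with y hy
      rw [hy, ENNReal.ofReal_toReal (ne_top_of_le_ne_top ENNReal.coe_ne_top (hc _))]
    · intro t ht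
      filter_upwards [eventually_orbitAverage_comp_le hν hT hφ hc hs ht,
        eventually_le_orbitAverage_comp hν hT hφ hc hs ht] with n h2 h3 y
      exact ⟨h3 y, h2 y⟩
  have hPconv : Convex ℝ P := by
    rintro u₁ ⟨hu₁, v₁, hv₁m, hv₁, hv₁t⟩ u₂ ⟨hu₂, v₂, hv₂m, hv₂, hv₂t⟩ a b ha hb hab
    have hab' : ENNReal.ofReal a + ENNReal.ofReal b = 1 := by
      rw [← ENNReal.ofReal_add ha hb, hab, ENNReal.ofReal_one]
    have hcoe : ∀ᵐ y ∂m, (a • u₁ + b • u₂ : Lp ℝ 2 m) y = a * u₁ y + b * u₂ y := by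
      filter_upwards [Lp.coeFn_add (a • u₁) (b • u₂), Lp.coeFn_smul a u₁,
        Lp.coeFn_smul b u₂] with y h1 h2 h3
      rw [h1, Pi.add_apply, h2, h3]; rfl
    refine ⟨?_, fun y => ENNReal.ofReal a * v₁ y + ENNReal.ofReal b * v₂ y,
      (hv₁m.const_mul _).add (hv₂m.const_mul _), ?_, fun t ht => ?_⟩
    · filter_upwards [hcoe, hu₁, hu₂] with y h1 h2 h3
      rw [h1]; positivity
    · filter_upwards [hcoe, hu₁, hu₂, hv₁, hv₂] with y h1 h2 h3 h4 h5
      rw [h1, ENNReal.ofReal_add (by positivity) (by positivity), ENNReal.ofReal_mul ha,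
        ENNReal.ofReal_mul hb, h4, h5]
    · filter_upwards [hv₁t t ht, hv₂t t ht] with n h1 h2 y
      rw [orbitAverage_add hT (hv₁m.const_mul _), orbitAverage_const_mul hT hv₁m,
        orbitAverage_const_mul hT hv₂m]
      have e : ∀ x : ℝ≥0∞, x = ENNReal.ofReal a * x + ENNReal.ofReal b * x := fun x => by
        rw [← add_mul, hab', one_mul]
      constructor
      · calc _ = _ := e _
          _ ≤ ENNReal.ofReal a * (orbitAverage ν T n v₁ y + t) +
              ENNReal.ofReal b * (orbitAverage ν T n v₂ y + t) := by
            gcongr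
            · exact (h1 y).1
            · exact (h2 y).1
          _ = _ := by conv_rhs => rw [e t]
                      ring
      · rw [e (orbitAverage ν T n φ y + t)]
        gcongr
        · exact (h1 y).2
        · exact (h2 y).2
  have hsub : convexHull ℝ (Set.range fun s : Set.Ici (0 : Fin d → R) =>
      Lp.compMeasurePreservingₗᵢ ℝ (T s) (hT.measurePreserving s) (hfL.toLp _)) ⊆ P :=
    convexHull_min (by rintro _ ⟨⟨s, hs⟩, rfl⟩; exact hPorb s hs) hPconv
  have hgm : Measurable (g : Y → ℝ) := (Lp.stronglyMeasurable g).measurable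
  refine ae_tendsto_of_approx hν hT fun η hη => ?_
  obtain ⟨u, hu, hug⟩ := EMetric.mem_closure_iff.1 hg η (pos_iff_ne_zero.2 hη)
  obtain ⟨-, v, hvm, hvu, hvt⟩ := hsub hu
  have hum : Measurable (u : Y → ℝ) := (Lp.stronglyMeasurable u).measurable
  have hr : Measurable fun y => ‖g y - u y‖ₑ := (hgm.sub hum).enorm
  refine ⟨fun y => ENNReal.ofReal (g y), fun y => ‖g y - u y‖ₑ, hr, ?_, ?_, ?_⟩
  · rw [← eLpNorm_one_eq_lintegral_enorm (f := fun y => g y - u y)]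
    refine (eLpNorm_le_eLpNorm_of_exponent_le (q := 2) one_le_two
      (hgm.sub hum).aestronglyMeasurable).trans ?_
    rw [Lp.edist_def] at hug
    exact hug.le
  · have hinv' : ∀ s : Fin d → R, 0 ≤ s →
        ∀ᵐ y ∂m, ENNReal.ofReal (g (T s y)) = ENNReal.ofReal (g y) := by
      intro s hs
      have h1 := Lp.coeFn_compMeasurePreserving g (hT.measurePreserving s)
      have h2 : Lp.compMeasurePreserving (T s) (hT.measurePreserving s) g = g := hinv s hs
      rw [h2] at h1
      filter_upwards [h1] with y hy
      rw [hy]; rfl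
    filter_upwards [ae_orbitAverage_eq_self hν hT hgm.ennreal_ofReal hinv'] with y hy
    refine ⟨ENNReal.ofReal (g y), tendsto_const_nhds.congr' ?_⟩
    filter_upwards [eventually_ne_atTop 0] with n hn
    exact (hy n hn).symm
  · have hle1 : ∀ᵐ y ∂m, v y ≤ ENNReal.ofReal (g y) + ‖g y - u y‖ₑ := by
      filter_upwards [hvu] with y hy
      rw [hy, Real.enorm_eq_ofReal_abs, ← abs_sub_comm]
      refine le_trans (ENNReal.ofReal_le_ofReal ?_) (ENNReal.ofReal_add_le)
      linarith [le_abs_self (u y - g y)]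
    have hle2 : ∀ᵐ y ∂m, ENNReal.ofReal (g y) ≤ v y + ‖g y - u y‖ₑ := by
      filter_upwards [hvu] with y hy
      rw [hy, Real.enorm_eq_ofReal_abs]
      refine le_trans (ENNReal.ofReal_le_ofReal ?_) (ENNReal.ofReal_add_le)
      linarith [le_abs_self (g y - u y)]
    filter_upwards [ae_orbitAverage_le (ν := ν) hT hle1, ae_orbitAverage_le (ν := ν) hT hle2]
      with y h1 h2 t ht
    filter_upwards [hvt t ht] with n hn
    have h1' := h1 n
    have h2' := h2 n
    rw [orbitAverage_add hT hgm.ennreal_ofReal] at h1'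
    rw [orbitAverage_add hT hvm] at h2'
    refine ⟨(hn y).1.trans (by gcongr), h2'.trans ?_⟩
    rw [add_right_comm]
    gcongr
    exact (hn y).2

theorem tendsto_lintegral_sub_min [IsFiniteMeasure m] {φ : Y → ℝ≥0∞} (hφ : Measurable φ)
    (hint : ∫⁻ y, φ y ∂m ≠ ∞) :
    Tendsto (fun k : ℕ => ∫⁻ y, (φ y - min (φ y) k) ∂m) atTop (𝓝 0) := by
  have := tendsto_lintegral_of_dominated_convergence (μ := m)
    (F := fun k : ℕ => fun y => φ y - min (φ y) k) (f := fun _ => 0) φ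
    (fun k => hφ.sub (hφ.min measurable_const))
    (fun k => Eventually.of_forall fun y => tsub_le_self)
    hint ?_
  · simpa using this
  · filter_upwards [ae_lt_top hφ hint] with y hy
    obtain ⟨N, hN⟩ := ENNReal.exists_nat_gt hy.ne
    refine tendsto_const_nhds.congr' ?_
    filter_upwards [eventually_ge_atTop N] with k hk
    rw [min_eq_left (hN.le.trans (by exact_mod_cast hk)), tsub_self]

/-- The pointwise ergodic theorem along cubes for integrable functions; the system need not be
ergodic. -/
theorem ae_tendsto_orbitAverage (hν : IsCubeMeasure ν) [IsProbabilityMeasure m]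
    (hT : IsMPS m T) {φ : Y → ℝ≥0∞} (hφ : Measurable φ) (hint : ∫⁻ y, φ y ∂m ≠ ∞) :
    ∀ᵐ y ∂m, ∃ l, Tendsto (fun n => orbitAverage ν T n φ y) atTop (𝓝 l) := by
  refine ae_tendsto_of_approx hν hT fun η hη => ?_
  obtain ⟨k, hk⟩ := ((tendsto_lintegral_sub_min hφ hint).eventually_lt_const
    (pos_iff_ne_zero.2 hη)).exists
  have hmin : Measurable fun y => min (φ y) (k : ℝ≥0∞) := hφ.min measurable_const
  refine ⟨fun y => min (φ y) k, fun y => φ y - min (φ y) k, hφ.sub hmin, hk.le,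
    ae_tendsto_orbitAverage_of_bounded hν hT (c := k) hmin (fun y => by simp),
    Eventually.of_forall fun y t _ => Eventually.of_forall fun n => ⟨?_, ?_⟩⟩
  · rw [← orbitAverage_add hT hmin]
    simp only [add_tsub_cancel_of_le (min_le_left _ _)]
    exact le_self_add
  · rw [add_assoc]
    exact (orbitAverage_mono (fun y => min_le_left _ _) n y).trans le_self_add

/-- The limit of the averages has the same integral as `φ`. -/
theorem lintegral_limsup_orbitAverage (hν : IsCubeMeasure ν) [IsProbabilityMeasure m]
    (hT : IsMPS m T) {φ : Y → ℝ≥0∞} (hφ : Measurable φ) (hint : ∫⁻ y, φ y ∂m ≠ ∞) :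
    ∫⁻ y, limsup (fun n => orbitAverage ν T n φ y) atTop ∂m = ∫⁻ y, φ y ∂m := by
  have := hν.sFinite
  refine le_antisymm ?_ ?_
  · calc ∫⁻ y, limsup (fun n => orbitAverage ν T n φ y) atTop ∂m
        = ∫⁻ y, liminf (fun n => orbitAverage ν T n φ y) atTop ∂m := by
          refine lintegral_congr_ae ?_
          filter_upwards [ae_tendsto_orbitAverage hν hT hφ hint] with y ⟨l, hl⟩
          rw [hl.limsup_eq, hl.liminf_eq]
      _ ≤ liminf (fun n => ∫⁻ y, orbitAverage ν T n φ y ∂m) atTop :=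
          lintegral_liminf_le fun n => measurable_orbitAverage hT hφ n
      _ = ∫⁻ y, φ y ∂m := by
          refine (tendsto_const_nhds.congr' ?_).liminf_eq
          filter_upwards [eventually_ne_atTop 0] with n hn
          exact (lintegral_orbitAverage hν hT hφ hn).symm
  · have hk : ∀ k : ℕ, ∫⁻ y, min (φ y) k ∂m ≤
        ∫⁻ y, limsup (fun n => orbitAverage ν T n φ y) atTop ∂m := by
      intro k
      have hmin : Measurable fun y => min (φ y) (k : ℝ≥0∞) := hφ.min measurable_const
      have hconv := ae_tendsto_orbitAverage_of_bounded hν hT (c := k) hmin (fun y => by simp)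
      have h1 := tendsto_lintegral_of_dominated_convergence (μ := m)
        (F := fun n y => orbitAverage ν T (n + 1) (fun y => min (φ y) k) y)
        (f := fun y => limsup (fun n => orbitAverage ν T n (fun y => min (φ y) k) y) atTop)
        (fun _ => k) (fun n => measurable_orbitAverage hT hmin _)
        (fun n => Eventually.of_forall fun y =>
          orbitAverage_le hν (fun y => min_le_right _ _) n.succ_ne_zero y) (by simp) (by
          filter_upwards [hconv] with y ⟨l, hl⟩
          rw [hl.limsup_eq]
          exact hl.comp (tendsto_add_atTop_nat 1))
      simp only [lintegral_orbitAverage hν hT hmin (Nat.succ_ne_zero _)] at h1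
      rw [tendsto_nhds_unique tendsto_const_nhds h1]
      exact lintegral_mono fun y => limsup_le_limsup (Eventually.of_forall fun n =>
        orbitAverage_mono (fun y => min_le_left _ _) n y)
    have h2 : ∀ k : ℕ, ∫⁻ y, φ y ∂m ≤ ∫⁻ y, limsup (fun n => orbitAverage ν T n φ y) atTop ∂m +
        ∫⁻ y, (φ y - min (φ y) k) ∂m := by
      intro k
      refine le_trans (le_of_eq ?_) (add_le_add (hk k) le_rfl)
      rw [← lintegral_add_left (hφ.min measurable_const)]
      simp only [add_tsub_cancel_of_le (min_le_left _ _)]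
    have h3 := (tendsto_const_nhds (x := ∫⁻ y, limsup (fun n => orbitAverage ν T n φ y) atTop ∂m)
      (f := atTop)).add (tendsto_lintegral_sub_min hφ hint)
    rw [add_zero] at h3
    exact ge_of_tendsto' h3 h2

theorem limsup_orbitAverage_comp_le (hν : IsCubeMeasure ν) (hT : IsMPS m T) {φ : Y → ℝ≥0∞}
    (hφ : Measurable φ) {s : Fin d → R} (hs : 0 ≤ s) (y : Y) :
    limsup (fun n => orbitAverage ν T n φ (T s y)) atTop ≤
      limsup (fun n => orbitAverage ν T n φ y) atTop := by
  obtain ⟨k, hk⟩ := exists_lintegral_cube_add_le hν hs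
  rw [← limsup_nat_add (fun n => orbitAverage ν T n φ y) k]
  refine le_of_forall_gt_imp_ge_of_dense fun c hc => ?_
  by_cases hct : c = ∞
  · simp [hct]
  have hlim : Tendsto (fun n => c * (ν (cube R d (n + k)) / ν (cube R d n))) atTop (𝓝 (c * 1)) :=
    ENNReal.Tendsto.const_mul (tendsto_measure_cube_div hν k) (.inr hct)
  rw [mul_one] at hlim
  rw [← hlim.limsup_eq]
  refine limsup_le_limsup ?_
  filter_upwards [eventually_lt_of_limsup_lt hc, eventually_ne_atTop 0] with n hn hn0
  have hn' : ∫⁻ j in cube R d (n + k), φ (T j y) ∂ν ≤ c * ν (cube R d (n + k)) :=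
    (ENNReal.div_le_iff (measure_cube_ne_zero hν (by omega)) (measure_cube_ne_top hν _)).1 hn.le
  calc orbitAverage ν T n φ (T s y)
      ≤ (∫⁻ j in cube R d (n + k), φ (T j y) ∂ν) / ν (cube R d n) := by
        refine ENNReal.div_le_div_right (le_trans (le_of_eq ?_)
          (hk n _ (hT.measurable_comp_orbit hφ y))) _
        simp only [hT.map_add]
    _ ≤ c * ν (cube R d (n + k)) / ν (cube R d n) := ENNReal.div_le_div_right hn' _
    _ = _ := mul_div_assoc _ _ _

omit [MeasurableAdd R] in
/-- In an ergodic system a set that is only mapped into itself by the `T s` with `s ≥ 0` has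
measure `0` or `1`: the increasing union of its preimages under the diagonal times `(n, …, n)` is
strictly invariant and has the same measure. -/
theorem measure_eq_zero_or_one_of_subset_preimage (hν : IsCubeMeasure ν) [IsProbabilityMeasure m]
    (hT : IsErgodicMPS m T) {B : Set Y} (hB : MeasurableSet B)
    (hsub : ∀ s, 0 ≤ s → B ⊆ T s ⁻¹' B) : m B = 0 ∨ m B = 1 := by
  let e : ℕ → Fin d → R := fun n _ => n
  have he : ∀ n, 0 ≤ e n := fun n i => Nat.cast_nonneg n
  have headd : ∀ a b, e (a + b) = e a + e b := fun a b => by ext i; simp [e]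
  have hTm := fun s => (hT.measurePreserving s).measurable
  have hmono : Monotone fun n => T (e n) ⁻¹' B := by
    intro a b hab y hy
    obtain ⟨c, rfl⟩ := Nat.exists_eq_add_of_le hab
    have := hsub _ (he c) hy
    rwa [Set.mem_preimage, ← hT.map_add, add_comm, ← headd] at this
  have hmeas : m (⋃ n, T (e n) ⁻¹' B) = m B := by
    rw [hmono.measure_iUnion]
    simp [(hT.measurePreserving _).measure_preimage hB.nullMeasurableSet]
  have hcompl : ∀ s : Fin d → R, ∃ n, 0 ≤ s + e n ∧ ∃ i, 0 ≤ i ∧ i + s = e n := by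
    intro s
    choose m₀ h₀ using fun i => hν.exists_compl (s i)
    have h := fun i => h₀ i (∑ i, m₀ i)
      (Finset.single_le_sum (f := m₀) (fun _ _ => Nat.zero_le _) (Finset.mem_univ i))
    choose h1 k hk using h
    exact ⟨∑ i, m₀ i, fun i => h1 i, k, fun i => (hk i).1, funext fun i => (hk i).2⟩
  rw [← hmeas]
  -- Invariance under all `s`: both `s + (p, …, p)` and `(p, …, p) - s` are nonnegative for
  -- large `p`.
  refine hT.ergodic _ (MeasurableSet.iUnion fun n => hTm _ hB) fun s => ?_
  obtain ⟨p, hp, i, hi, his⟩ := hcompl s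
  ext y
  simp only [Set.preimage_iUnion, Set.mem_iUnion, Set.mem_preimage]
  constructor
  · rintro ⟨n, hn⟩
    refine ⟨p + n, ?_⟩
    have := hsub i hi hn
    rw [Set.mem_preimage, ← hT.map_add, ← hT.map_add] at this
    rwa [headd, ← his, add_right_comm, add_assoc, add_comm s] at *
  · rintro ⟨n, hn⟩
    refine ⟨p + n, ?_⟩
    have := hsub _ hp hn
    rw [Set.mem_preimage, ← hT.map_add] at this
    rw [← hT.map_add, headd]
    convert this using 2
    abel

/-- The pointwise ergodic theorem along cubes in an ergodic system. -/
theorem ae_tendsto_orbitAverage_lintegral (hν : IsCubeMeasure ν) [IsProbabilityMeasure m]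
    (hT : IsErgodicMPS m T) {φ : Y → ℝ≥0∞} (hφ : Measurable φ) (hint : ∫⁻ y, φ y ∂m ≠ ∞) :
    ∀ᵐ y ∂m, Tendsto (fun n => orbitAverage ν T n φ y) atTop (𝓝 (∫⁻ y, φ y ∂m)) := by
  have := hν.sFinite
  set l : Y → ℝ≥0∞ := fun y => limsup (fun n => orbitAverage ν T n φ y) atTop
  have hl : Measurable l := Measurable.limsup fun n => measurable_orbitAverage hT.toIsMPS hφ n
  have hlint : ∫⁻ y, l y ∂m = ∫⁻ y, φ y ∂m := lintegral_limsup_orbitAverage hν hT.toIsMPS hφ hint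
  -- The set `{l < ∫ φ}` is trivial by ergodicity, and not of full measure because `∫ l = ∫ φ`.
  have hge : ∀ᵐ y ∂m, ∫⁻ y, φ y ∂m ≤ l y := by
    have hBm : MeasurableSet {y | l y < ∫⁻ y, φ y ∂m} := measurableSet_lt hl measurable_const
    rcases measure_eq_zero_or_one_of_subset_preimage hν hT hBm
      (fun s hs y hy => (limsup_orbitAverage_comp_le hν hT.toIsMPS hφ hs y).trans_lt hy) with h | h
    · filter_upwards [measure_eq_zero_iff_ae_notMem.1 h] with y hy
      exact not_lt.1 hy
    · have h1 : ∀ᵐ y ∂m, l y < ∫⁻ y, φ y ∂m := (mem_ae_iff_prob_eq_one hBm).2 h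
      have h2 := lintegral_strict_mono (IsProbabilityMeasure.ne_zero m)
        (aemeasurable_const (b := ∫⁻ y, φ y ∂m)) (hlint ▸ hint) h1
      simp [hlint] at h2
  have heq := ae_eq_of_ae_le_of_lintegral_le hge (by simpa using hint) hl.aemeasurable
    (by simp [hlint])
  filter_upwards [heq, ae_tendsto_orbitAverage hν hT.toIsMPS hφ hint] with y hy ⟨c, hc⟩
  rw [hy]
  simp only [l]
  rwa [hc.limsup_eq]

end Ergodic

/-! ### Almost periodicity and mean sensitivity -/

section L2

variable {X : Type*} [MeasurableSpace X] {μ : Measure X}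

theorem lintegral_enorm_sq_eq (g : X → ℂ) :
    ∫⁻ x, ‖g x‖ₑ ^ 2 ∂μ = eLpNorm g 2 μ ^ 2 := by
  have := eLpNorm_nnreal_pow_eq_lintegral (f := g) (μ := μ) (p := 2) two_ne_zero
  simp only [NNReal.coe_ofNat, ENNReal.coe_ofNat, ENNReal.rpow_ofNat] at this
  exact this.symm

theorem enorm_sub_sq_le (a b : ℂ) : ‖a - b‖ₑ ^ 2 ≤ 4 * (‖a‖ₑ ^ 2 + ‖b‖ₑ ^ 2) := by
  have h1 : ‖a - b‖ₑ ≤ 2 * max ‖a‖ₑ ‖b‖ₑ := by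
    refine enorm_sub_le.trans ?_
    rw [two_mul]
    exact add_le_add (le_max_left _ _) (le_max_right _ _)
  calc ‖a - b‖ₑ ^ 2 ≤ (2 * max ‖a‖ₑ ‖b‖ₑ) ^ 2 := by gcongr
    _ = 4 * max ‖a‖ₑ ‖b‖ₑ ^ 2 := by rw [mul_pow]; norm_num
    _ ≤ _ := by
        gcongr
        rcases max_cases ‖a‖ₑ ‖b‖ₑ with ⟨h, -⟩ | ⟨h, -⟩ <;> rw [h]
        · exact le_self_add
        · exact le_add_self

/-- The coupling of `μ` with itself which joins two points that are independent given that `π`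
takes the same value at both. -/
theorem exists_selfCoupling_of_simpleFunc [IsProbabilityMeasure μ] {β : Type*}
    (π : SimpleFunc X β) :
    ∃ lam : Measure (X × X), lam ≪ μ.prod μ ∧ MeasurePreserving Prod.fst lam μ ∧
      MeasurePreserving Prod.snd lam μ ∧ ∀ᵐ p ∂lam, π p.1 = π p.2 := by
  let B : β → Set X := fun v => π ⁻¹' {v}
  have hB : ∀ v, MeasurableSet (B v) := fun v => π.measurableSet_fiber v
  let lam : Measure (X × X) :=
    ∑ v ∈ π.range, (μ (B v))⁻¹ • (μ.restrict (B v)).prod (μ.restrict (B v))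
  have happ : ∀ s, lam s =
      ∑ v ∈ π.range, (μ (B v))⁻¹ * (μ.restrict (B v)).prod (μ.restrict (B v)) s := by
    intro s
    simp only [lam, Measure.finsetSum_apply, Measure.smul_apply, smul_eq_mul]
  have hsum : ∀ A, MeasurableSet A →
      ∑ v ∈ π.range, (μ (B v))⁻¹ * (μ (A ∩ B v) * μ (B v)) = μ A := by
    intro A hA
    have h1 : ∀ v, (μ (B v))⁻¹ * (μ (A ∩ B v) * μ (B v)) = μ (A ∩ B v) := by
      intro v
      by_cases h0 : μ (B v) = 0
      · simp [h0, measure_mono_null (Set.inter_subset_right (s := A) (t := B v)) h0]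
      · rw [mul_left_comm, ENNReal.inv_mul_cancel h0 (measure_ne_top _ _), mul_one]
    simp only [h1]
    rw [← measure_biUnion_finset]
    · congr 1
      ext x
      simp only [Set.mem_iUnion, Set.mem_inter_iff, exists_and_left, exists_prop, B,
        Set.mem_preimage, Set.mem_singleton_iff, and_iff_left_iff_imp]
      intro _
      exact ⟨π x, π.mem_range_self x, rfl⟩
    · intro v _ w _ hvw
      refine Set.disjoint_left.2 fun x hx hx' => hvw ?_
      exact hx.2.symm.trans hx'.2
    · exact fun v _ => hA.inter (hB v)
  refine ⟨lam, ?_, ⟨measurable_fst, ?_⟩, ⟨measurable_snd, ?_⟩, ?_⟩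
  · refine Measure.AbsolutelyContinuous.mk fun s hs h0 => ?_
    rw [happ]
    refine Finset.sum_eq_zero fun v _ => ?_
    rw [Measure.prod_restrict, Measure.restrict_apply hs,
      measure_mono_null Set.inter_subset_left h0, mul_zero]
  · ext A hA
    rw [Measure.map_apply measurable_fst hA, happ, ← hsum A hA]
    refine Finset.sum_congr rfl fun v _ => ?_
    rw [← Set.prod_univ, Measure.prod_prod, Measure.restrict_apply hA,
      Measure.restrict_apply_univ]
  · ext A hA
    rw [Measure.map_apply measurable_snd hA, happ, ← hsum A hA]
    refine Finset.sum_congr rfl fun v _ => ?_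
    rw [← Set.univ_prod, Measure.prod_prod, Measure.restrict_apply hA,
      Measure.restrict_apply_univ, mul_comm (μ (B v)) (μ (A ∩ B v))]
  · rw [ae_iff, happ]
    refine Finset.sum_eq_zero fun v _ => ?_
    rw [Measure.prod_restrict]
    have : ∀ᵐ p ∂(μ.prod μ).restrict (B v ×ˢ B v), π p.1 = π p.2 := by
      filter_upwards [ae_restrict_mem ((hB v).prod (hB v))] with p hp
      exact hp.1.trans hp.2.symm
    rw [ae_iff.1 this, mul_zero]

/-- A self-coupling of `μ`, absolutely continuous with respect to `μ × μ`, under which finitely many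
prescribed simple functions take the same value at both points. -/
theorem exists_selfCoupling [IsProbabilityMeasure μ] {H : Set (SimpleFunc X ℂ)} (hH : H.Finite) :
    ∃ lam : Measure (X × X), lam ≪ μ.prod μ ∧ MeasurePreserving Prod.fst lam μ ∧
      MeasurePreserving Prod.snd lam μ ∧ ∀ h ∈ H, ∀ᵐ p ∂lam, h p.1 = h p.2 := by
  have := hH.to_subtype
  let π : SimpleFunc X (H → ℂ) :=
    { toFun := fun x h => h.1 x
      measurableSet_fiber' := fun v => by
        have : (fun (x : X) (h : H) => h.1 x) ⁻¹' {v} = ⋂ h : H, h.1 ⁻¹' {v h} := by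
          ext x
          simp [funext_iff]
        rw [this]
        exact MeasurableSet.iInter fun h => h.1.measurableSet_fiber _
      finite_range' := by
        refine (Set.Finite.pi' fun h : H => h.1.finite_range).subset ?_
        rintro _ ⟨x, rfl⟩ h
        exact ⟨x, rfl⟩ }
  obtain ⟨lam, h1, h2, h3, h4⟩ := exists_selfCoupling_of_simpleFunc (μ := μ) π
  refine ⟨lam, h1, h2, h3, fun h hh => ?_⟩
  filter_upwards [h4] with p hp
  exact congrFun hp ⟨h, hh⟩

end L2

section Systems

variable {R : Type*} [CommSemiring R] [PartialOrder R] [IsStrictOrderedRing R] [MeasurableSpace R]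
  [MeasurableAdd R] {d : ℕ} {ν : Measure (Fin d → R)} {X : Type*} [MeasurableSpace X]
  {μ : Measure X} {T : (Fin d → R) → X → X}

omit [PartialOrder R] [IsStrictOrderedRing R] [MeasurableAdd R] in
theorem IsMPS.prod [SFinite μ] (hT : IsMPS μ T) :
    IsMPS (μ.prod μ) (fun j => Prod.map (T j) (T j)) where
  measurable_uncurry :=
    (hT.measurable_uncurry.comp (measurable_fst.prodMk (measurable_fst.comp measurable_snd))).prodMk
      (hT.measurable_uncurry.comp (measurable_fst.prodMk (measurable_snd.comp measurable_snd)))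
  map_zero _ := Prod.ext (hT.map_zero _) (hT.map_zero _)
  map_add _ _ _ := Prod.ext (hT.map_add _ _ _) (hT.map_add _ _ _)
  measurePreserving j := (hT.measurePreserving j).prod (hT.measurePreserving j)

omit [PartialOrder R] [IsStrictOrderedRing R] [MeasurableAdd R] in
theorem edist_koopman_sq (hT : IsMPS μ T) (f : Lp ℂ 2 μ) (s t : Fin d → R) :
    ∫⁻ x, ‖f (T s x) - f (T t x)‖ₑ ^ 2 ∂μ =
      edist (koopman (hT.measurePreserving s) f) (koopman (hT.measurePreserving t) f) ^ 2 := by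
  rw [lintegral_enorm_sq_eq (fun x => f (T s x) - f (T t x)), Lp.edist_def]
  congr 1
  refine eLpNorm_congr_ae ?_
  filter_upwards [Lp.coeFn_compMeasurePreserving f (hT.measurePreserving s),
    Lp.coeFn_compMeasurePreserving f (hT.measurePreserving t)] with x h1 h2
  rw [Pi.sub_apply]
  exact congrArg₂ _ h1.symm h2.symm

theorem ae_isGenericSq (hν : IsCubeMeasure ν) [IsProbabilityMeasure μ] (hT : IsErgodicMPS μ T)
    (f : Lp ℂ 2 μ) : ∀ᵐ x ∂μ, IsGenericSq ν μ T f x := by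
  refine ae_tendsto_orbitAverage_lintegral hν hT
    ((Lp.stronglyMeasurable f).measurable.enorm.pow_const 2) ?_
  rw [lintegral_enorm_sq_eq]
  exact ENNReal.pow_ne_top (Lp.eLpNorm_ne_top f)

/-- Along almost every orbit `d_f` reproduces the distances in the orbit of `f` in `L²`. -/
theorem ae_meanDist_orbit (hν : IsCubeMeasure ν) [IsProbabilityMeasure μ] (hT : IsErgodicMPS μ T)
    (f : Lp ℂ 2 μ) (s t : Fin d → R) :
    ∀ᵐ x ∂μ, meanDist ν T f (T s x) (T t x) =
      edist (koopman (hT.measurePreserving s) f) (koopman (hT.measurePreserving t) f) := by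
  have hfm := (Lp.stronglyMeasurable f).measurable
  have hm : Measurable fun x => ‖f (T s x) - f (T t x)‖ₑ ^ 2 :=
    ((hfm.comp (hT.measurePreserving s).measurable).sub
      (hfm.comp (hT.measurePreserving t).measurable)).enorm.pow_const 2
  have hI := edist_koopman_sq hT.toIsMPS f s t
  have h := ae_tendsto_orbitAverage_lintegral hν hT hm (by
    rw [hI]; exact ENNReal.pow_ne_top (edist_ne_top _ _))
  filter_upwards [h] with x hx
  rw [hI] at hx
  have hcomm : ∀ i j : Fin d → R, T i (T j x) = T j (T i x) := fun i j => by
    rw [← hT.map_add, ← hT.map_add, add_comm]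
  have h2 := ((ENNReal.continuous_rpow_const (y := (1 / 2 : ℝ))).tendsto _).comp hx
  refine Tendsto.limsup_eq ?_
  have e : ∀ a : ℝ≥0∞, (a ^ 2) ^ (1 / 2 : ℝ) = a := fun a => by
    rw [← ENNReal.rpow_natCast, ← ENNReal.rpow_mul]
    norm_num
  rw [e] at h2
  refine h2.congr fun n => ?_
  simp only [Function.comp, orbitAverage, hcomm s, hcomm t]

theorem exists_separated_seq {G E : Type*} [PseudoMetricSpace E] (u : G → E)
    (hu : ¬ TotallyBounded (Set.range u)) :
    ∃ δ > 0, ∃ s : ℕ → G, ∀ m n, m < n → δ ≤ dist (u (s m)) (u (s n)) := by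
  rw [Metric.totallyBounded_iff] at hu
  push Not at hu
  obtain ⟨δ, hδ, h⟩ := hu
  obtain ⟨s, -, hs⟩ := exists_seq_of_forall_finset_exists (fun _ : G => True)
    (fun a b => δ ≤ dist (u a) (u b)) (fun F _ => by
      have := h (u '' F) (F.finite_toSet.image _)
      rw [Set.not_subset] at this
      obtain ⟨_, ⟨b, rfl⟩, hb⟩ := this
      refine ⟨b, trivial, fun a ha => ?_⟩
      by_contra hlt
      refine hb (Set.mem_biUnion (Set.mem_image_of_mem u ha) ?_)
      rw [Metric.mem_ball, dist_comm]
      exact not_le.1 hlt)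
  exact ⟨δ, hδ, s, hs⟩

theorem mem_meanSensitive_of_notMem_almostPeriodic (hν : IsCubeMeasure ν) [IsProbabilityMeasure μ]
    (hT : IsErgodicMPS μ T) {f : Lp ℂ 2 μ} (hf : f ∉ almostPeriodic hT.toIsMPS) :
    f ∈ meanSensitive ν μ T := by
  have hnb : ¬ TotallyBounded (Set.range fun j => koopman (hT.measurePreserving j) f) := fun h =>
    hf (isCompact_iff_totallyBounded_isComplete.2 ⟨h.closure, isClosed_closure.isComplete⟩)
  obtain ⟨δ, hδ, s, hs⟩ := exists_separated_seq _ hnb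
  refine ⟨δ / 2, half_pos hδ, fun A hA hA0 => ?_⟩
  have hgood : ∀ᵐ x ∂μ, (∀ n, IsGenericSq ν μ T f (T (s n) x)) ∧
      ∀ m n, meanDist ν T f (T (s m) x) (T (s n) x) =
        edist (koopman (hT.measurePreserving (s m)) f)
          (koopman (hT.measurePreserving (s n)) f) := by
    refine (ae_all_iff.2 fun n => ?_).and
      (ae_all_iff.2 fun m => ae_all_iff.2 fun n => ae_meanDist_orbit hν hT f _ _)
    exact (hT.measurePreserving (s n)).quasiMeasurePreserving.ae (ae_isGenericSq hν hT f)
  obtain ⟨N, hN, hNm, hN0⟩ := exists_measurable_superset_of_null (ae_iff.1 hgood)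
  have hpre : ∀ n, μ (T (s n) ⁻¹' A \ N) = μ A := fun n => by
    rw [measure_sdiff_null hN0, (hT.measurePreserving (s n)).measure_preimage hA.nullMeasurableSet]
  -- Infinitely many sets of equal positive measure cannot be pairwise disjoint.
  obtain ⟨i, j, hij, x, hxi, hxj⟩ := exists_nonempty_inter_of_measure_univ_lt_tsum_measure μ
    (s := fun n => T (s n) ⁻¹' A \ N)
    (fun n => ((hT.measurePreserving (s n)).measurable hA).diff hNm |>.nullMeasurableSet) (by
      simp only [hpre, measure_univ]
      rw [ENNReal.tsum_const_eq_top_of_ne_zero hA0.ne']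
      exact ENNReal.one_lt_top)
  have hx := not_not.1 fun h => hxi.2 (hN h)
  refine ⟨_, hxi.1, _, hxj.1, hx.1 i, hx.1 j, ?_⟩
  rw [hx.2 i j, edist_dist]
  refine (ENNReal.ofReal_lt_ofReal_iff_of_nonneg (half_pos hδ).le).2
    ((half_lt_self hδ).trans_le ?_)
  rcases lt_or_gt_of_ne hij with h | h
  · exact hs _ _ h
  · rw [dist_comm]; exact hs _ _ h

omit [IsStrictOrderedRing R] [MeasurableAdd R] in
/-- Minkowski's inequality for the quadratic means defining `d_f`. -/
theorem cubeAverage_rpow_half_triangle {a b c : (Fin d → R) → ℂ} (n : ℕ) (ha : Measurable a)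
    (hb : Measurable b) (hc : Measurable c) :
    (cubeAverage ν n fun j => ‖b j - c j‖ₑ ^ 2) ^ (1 / 2 : ℝ) ≤
      (cubeAverage ν n fun j => ‖a j - b j‖ₑ ^ 2) ^ (1 / 2 : ℝ) +
      (cubeAverage ν n fun j => ‖a j - c j‖ₑ ^ 2) ^ (1 / 2 : ℝ) := by
  let ρ : Measure (Fin d → R) := (ν (cube R d n))⁻¹ • ν.restrict (cube R d n)
  have hρ : ∀ g : (Fin d → R) → ℝ≥0∞, (cubeAverage ν n fun j => g j ^ 2) =
      ∫⁻ j, g j ^ (2 : ℝ) ∂ρ := by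
    intro g
    rw [lintegral_smul_measure, cubeAverage, ENNReal.div_eq_inv_mul, smul_eq_mul]
    simp
  rw [hρ, hρ, hρ]
  refine le_trans ?_ (ENNReal.lintegral_Lp_add_le (μ := ρ) (ha.sub hb).enorm.aemeasurable
    (ha.sub hc).enorm.aemeasurable one_le_two)
  gcongr with j
  have : b j - c j = (a j - c j) - (a j - b j) := by ring
  rw [this, Pi.add_apply, add_comm]
  exact enorm_sub_le

omit [PartialOrder R] [IsStrictOrderedRing R] [MeasurableAdd R] in
/-- For almost periodic `f` there is an absolutely continuous self-coupling of `μ` under which all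
the functions `U^j f` take close values at the two points. -/
theorem exists_selfCoupling_of_almostPeriodic [IsProbabilityMeasure μ] (hT : IsMPS μ T)
    {f : Lp ℂ 2 μ} (hf : f ∈ almostPeriodic hT) {r : ℝ≥0∞} (hr : r ≠ 0) :
    ∃ lam : Measure (X × X), lam ≪ μ.prod μ ∧ IsProbabilityMeasure lam ∧
      ∀ j, ∫⁻ p, ‖f (T j p.1) - f (T j p.2)‖ₑ ^ 2 ∂lam ≤ 32 * r ^ 2 := by
  have hfm := (Lp.stronglyMeasurable f).measurable
  obtain ⟨t, htf, ht⟩ := EMetric.totallyBounded_iff.1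
    (IsCompact.totallyBounded hf |>.subset subset_closure) r (pos_iff_ne_zero.2 hr)
  choose h hh using fun g : Lp ℂ 2 μ =>
    (Lp.memLp g).exists_simpleFunc_eLpNorm_sub_lt ENNReal.ofNat_ne_top hr
  obtain ⟨lam, hac, hfst, hsnd, hlam⟩ := exists_selfCoupling (μ := μ) (htf.image h)
  have hprob : IsProbabilityMeasure lam := ⟨by
    have := hfst.measure_preimage (s := Set.univ) MeasurableSet.univ.nullMeasurableSet
    simpa using this⟩
  refine ⟨lam, hac, hprob, fun j => ?_⟩
  have hj := ht ⟨j, rfl⟩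
  simp only [Set.mem_iUnion, exists_prop] at hj
  obtain ⟨g, hgt, hg⟩ := hj
  have hTm := (hT.measurePreserving j).measurable
  have hdm : Measurable fun x => f (T j x) - h g x := (hfm.comp hTm).sub (h g).measurable
  have hbound : ∫⁻ x, ‖f (T j x) - h g x‖ₑ ^ 2 ∂μ ≤ 4 * r ^ 2 := by
    rw [lintegral_enorm_sq_eq (fun x => f (T j x) - h g x)]
    have e : (fun x => f (T j x) - h g x) =ᵐ[μ]
        (koopman (hT.measurePreserving j) f - g : X → ℂ) + (g - h g : X → ℂ) := by
      filter_upwards [Lp.coeFn_compMeasurePreserving f (hT.measurePreserving j)] with x hx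
      have hx' : koopman (hT.measurePreserving j) f x = f (T j x) := hx
      simp [hx']
    have h1 : eLpNorm (fun x => f (T j x) - h g x) 2 μ ≤ r + r := by
      rw [eLpNorm_congr_ae e]
      refine (eLpNorm_add_le ((Lp.aestronglyMeasurable _).sub (Lp.aestronglyMeasurable _))
        ((Lp.aestronglyMeasurable _).sub (h g).aestronglyMeasurable) one_le_two).trans ?_
      refine add_le_add ?_ (hh g).1.le
      rw [← Lp.edist_def]
      exact (Metric.mem_eball.1 hg).le
    calc _ ≤ (r + r) ^ 2 := by gcongr
      _ = _ := by ring
  calc ∫⁻ p, ‖f (T j p.1) - f (T j p.2)‖ₑ ^ 2 ∂lam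
      ≤ ∫⁻ p, 4 * (‖f (T j p.1) - h g p.1‖ₑ ^ 2 + ‖f (T j p.2) - h g p.2‖ₑ ^ 2) ∂lam := by
        refine lintegral_mono_ae ?_
        filter_upwards [hlam (h g) (Set.mem_image_of_mem h hgt)] with p hp
        refine le_trans (le_of_eq ?_) (enorm_sub_sq_le _ _)
        rw [hp]
        congr 2
        ring
    _ = 4 * (∫⁻ x, ‖f (T j x) - h g x‖ₑ ^ 2 ∂μ + ∫⁻ x, ‖f (T j x) - h g x‖ₑ ^ 2 ∂μ) := by
        have hm := hdm.enorm.pow_const 2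
        rw [lintegral_const_mul, lintegral_add_left]
        · congr 2
          · exact hfst.lintegral_comp hm
          · exact hsnd.lintegral_comp hm
        · exact hm.comp measurable_fst
        · exact (hm.comp measurable_fst).add (hm.comp measurable_snd)
    _ ≤ 4 * (4 * r ^ 2 + 4 * r ^ 2) := by gcongr
    _ = _ := by ring

theorem notMem_meanSensitive_of_mem_almostPeriodic (hν : IsCubeMeasure ν) [IsProbabilityMeasure μ]
    (hT : IsMPS μ T) {f : Lp ℂ 2 μ} (hf : f ∈ almostPeriodic hT) :
    f ∉ meanSensitive ν μ T := by
  rintro ⟨ε, hε, hms⟩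
  have := hν.sFinite
  have hfm := (Lp.stronglyMeasurable f).measurable
  let S : (Fin d → R) → X × X → X × X := fun j => Prod.map (T j) (T j)
  have hS : IsMPS (μ.prod μ) S := hT.prod
  let F : X × X → ℝ≥0∞ := fun p => ‖f p.1 - f p.2‖ₑ ^ 2
  have hF : Measurable F :=
    ((hfm.comp measurable_fst).sub (hfm.comp measurable_snd)).enorm.pow_const 2
  have hFint : ∫⁻ p, F p ∂μ.prod μ ≠ ∞ := by
    have hm := hfm.enorm.pow_const 2
    have hlt : ∫⁻ x, ‖f x‖ₑ ^ 2 ∂μ ≠ ∞ := by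
      rw [lintegral_enorm_sq_eq]
      exact ENNReal.pow_ne_top (Lp.eLpNorm_ne_top f)
    refine ne_top_of_le_ne_top ?_ (lintegral_mono fun p : X × X => enorm_sub_sq_le (f p.1) (f p.2))
    rw [lintegral_const_mul (f := fun p : X × X => ‖f p.1‖ₑ ^ 2 + ‖f p.2‖ₑ ^ 2) _
        ((hm.comp measurable_fst).add (hm.comp measurable_snd)),
      lintegral_add_left (f := fun p : X × X => ‖f p.1‖ₑ ^ 2) (hm.comp measurable_fst),
      measurePreserving_fst.lintegral_comp hm, measurePreserving_snd.lintegral_comp hm]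
    exact ENNReal.mul_ne_top (by simp) (ENNReal.add_ne_top.2 ⟨hlt, hlt⟩)
  let L : X × X → ℝ≥0∞ := fun p => limsup (fun n => orbitAverage ν S n F p) atTop
  have hL : Measurable L := Measurable.limsup fun n => measurable_orbitAverage hS hF n
  set η : ℝ≥0∞ := ENNReal.ofReal (ε / 2) with hη
  have hη0 : η ≠ 0 := by simpa [hη] using hε
  obtain ⟨r, hr0, hr⟩ : ∃ r : ℝ≥0∞, r ≠ 0 ∧ 32 * r ^ 2 < η ^ 2 := by
    refine ⟨ENNReal.ofReal (ε / 16), by simpa using hε, ?_⟩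
    rw [hη, ← ENNReal.ofReal_pow (by positivity), ← ENNReal.ofReal_pow (by positivity),
      ← ENNReal.ofReal_ofNat 32, ← ENNReal.ofReal_mul (by norm_num)]
    exact (ENNReal.ofReal_lt_ofReal_iff (by positivity)).2 (by nlinarith)
  obtain ⟨lam, hac, hprob, hlam⟩ := exists_selfCoupling_of_almostPeriodic hT hf hr0
  have hLlam : ∫⁻ p, L p ∂lam ≤ 32 * r ^ 2 := by
    calc ∫⁻ p, L p ∂lam = ∫⁻ p, liminf (fun n => orbitAverage ν S n F p) atTop ∂lam := by
          refine lintegral_congr_ae ?_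
          filter_upwards [hac.ae_le (ae_tendsto_orbitAverage hν hS hF hFint)] with p ⟨l, hl⟩
          simp only [L]
          rw [hl.limsup_eq, hl.liminf_eq]
      _ ≤ liminf (fun n => ∫⁻ p, orbitAverage ν S n F p ∂lam) atTop :=
          lintegral_liminf_le fun n => measurable_orbitAverage hS hF n
      _ ≤ liminf (fun _ => 32 * r ^ 2) atTop := by
          refine liminf_le_liminf ?_
          filter_upwards [eventually_ne_atTop 0] with n hn
          simp only [orbitAverage, cubeAverage, ENNReal.div_eq_inv_mul]
          rw [lintegral_const_mul _ (measurable_lintegral_orbit hS hF n), lintegral_lintegral_swap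
            (f := fun p j => F (S j p))
            ((hF.comp hS.measurable_uncurry).comp measurable_swap).aemeasurable]
          calc (ν (cube R d n))⁻¹ * ∫⁻ j in cube R d n, ∫⁻ p, F (S j p) ∂lam ∂ν
              ≤ (ν (cube R d n))⁻¹ * ∫⁻ j in cube R d n, 32 * r ^ 2 ∂ν := by
                gcongr with j
                exact hlam j
            _ = 32 * r ^ 2 := by
                rw [setLIntegral_const, mul_left_comm, ENNReal.inv_mul_cancel
                  (measure_cube_ne_zero hν hn) (measure_cube_ne_top hν n), mul_one]
      _ = 32 * r ^ 2 := liminf_const _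
  have hDm : MeasurableSet {p | L p < η ^ 2} := measurableSet_lt hL measurable_const
  -- `L` is the square of `d_f`, its `lam`-mean is less than `η ^ 2`, and `lam ≪ μ × μ`.
  have hD : (μ.prod μ) {p | L p < η ^ 2} ≠ 0 := by
    intro h0
    have h1 : ∀ᵐ p ∂lam, η ^ 2 ≤ L p := by
      filter_upwards [measure_eq_zero_iff_ae_notMem.1 (hac h0)] with p hp
      exact not_lt.1 hp
    have h2 := lintegral_mono_ae h1
    rw [lintegral_const, measure_univ, mul_one] at h2
    exact (h2.trans (hLlam.trans hr.le)).not_gt (h2.trans_lt (hLlam.trans_lt hr))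
  rw [Ne, Measure.measure_prod_null hDm] at hD
  obtain ⟨x, hx⟩ : ∃ x, μ (Prod.mk x ⁻¹' {p | L p < η ^ 2}) ≠ 0 := by
    by_contra! h
    exact hD (Eventually.of_forall h)
  obtain ⟨y, hy, z, hz, -, -, hyz⟩ := hms _ (measurable_prodMk_left hDm) (pos_iff_ne_zero.2 hx)
  refine hyz.not_ge ?_
  have horb : ∀ w, Measurable fun j => f (T j w) := fun w =>
    hfm.comp (hT.measurable_uncurry.comp (measurable_id.prodMk measurable_const))
  have e : (η ^ 2) ^ (1 / 2 : ℝ) = η := by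
    rw [← ENNReal.rpow_natCast, ← ENNReal.rpow_mul]
    norm_num
  refine limsup_le_of_le (h := ?_)
  filter_upwards [eventually_lt_of_limsup_lt (show L (x, y) < η ^ 2 from hy),
    eventually_lt_of_limsup_lt (show L (x, z) < η ^ 2 from hz)] with n h1 h2
  calc _ ≤ _ := cubeAverage_rpow_half_triangle n (horb x) (horb y) (horb z)
    _ ≤ (η ^ 2) ^ (1 / 2 : ℝ) + (η ^ 2) ^ (1 / 2 : ℝ) :=
        add_le_add (ENNReal.rpow_le_rpow h1.le (by norm_num))
          (ENNReal.rpow_le_rpow h2.le (by norm_num))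
    _ = ENNReal.ofReal ε := by
        rw [e, hη, ← ENNReal.ofReal_add (by positivity) (by positivity), add_halves]

theorem compl_almostPeriodic_eq_meanSensitive (hν : IsCubeMeasure ν) [IsProbabilityMeasure μ]
    (hT : IsErgodicMPS μ T) : (almostPeriodic hT.toIsMPS)ᶜ = meanSensitive ν μ T :=
  Set.Subset.antisymm (fun _ hf => mem_meanSensitive_of_notMem_almostPeriodic hν hT hf)
    fun _ hf h => notMem_meanSensitive_of_mem_almostPeriodic hν hT.toIsMPS h hf

end Systems

end MeanSensitivity

theorem mainTheorem2 {X : Type*} [MeasurableSpace X] [StandardBorelSpace X]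
    (μ : Measure X) [IsProbabilityMeasure μ] (d : ℕ) :
    (∀ (T : (Fin d → ℤ) → X → X) (hT : MeanSensitivity.IsErgodicMPS μ T),
      (MeanSensitivity.almostPeriodic hT.toIsMPS)ᶜ =
        MeanSensitivity.meanSensitive Measure.count μ T) ∧
    (∀ (T : (Fin d → ℝ) → X → X) (hT : MeanSensitivity.IsErgodicMPS μ T),
      (MeanSensitivity.almostPeriodic hT.toIsMPS)ᶜ =
        MeanSensitivity.meanSensitive volume μ T) ∧
    (∀ (T : (Fin d → ℕ) → X → X) (hT : MeanSensitivity.IsErgodicMPS μ T),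
      (MeanSensitivity.almostPeriodic hT.toIsMPS)ᶜ =
        MeanSensitivity.meanSensitive Measure.count μ T) ∧
    (∀ (T : (Fin d → ℝ≥0) → X → X) (hT : MeanSensitivity.IsErgodicMPS μ T),
      (MeanSensitivity.almostPeriodic hT.toIsMPS)ᶜ =
        MeanSensitivity.meanSensitive (MeanSensitivity.orthantVolume d) μ T) := by
  refine ⟨fun T hT => ?_, fun T hT => ?_, fun T hT => ?_, fun T hT => ?_⟩
  · exact MeanSensitivity.compl_almostPeriodic_eq_meanSensitive
      (MeanSensitivity.isCubeMeasure_count_int d) hT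
  · exact MeanSensitivity.compl_almostPeriodic_eq_meanSensitive
      (MeanSensitivity.isCubeMeasure_volume d) hT
  · exact MeanSensitivity.compl_almostPeriodic_eq_meanSensitive
      (MeanSensitivity.isCubeMeasure_count_nat d) hT
  · exact MeanSensitivity.compl_almostPeriodic_eq_meanSensitive
      (MeanSensitivity.isCubeMeasure_orthantVolume d) hT
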